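/- **Setting and notation.** Let $(D,\mu)$ be an arbitrary measure space; functions $D\to\mathbb C$ are treated as functions, not as equivalence classes, and $\|\cdot\|_2$, $\langle f,g\rangle_2=\int_D f\,\overline g\,d\mu$ refer to $L_2=L_2(D,\mu)$. A *nested sequence of subspaces of $L_2$* is a sequence $(V_m)_{m\ge 1}$ of linear spaces of square-integrable functions $D\to\mathbb C$ with $\dim V_m=m$, with $V_m\subset V_{m+1}$ for all $m\ge1$, and such that no nonzero element of $V_m$ vanishes $\mu$-almost everywhere (that is, $V_m$ has dimension $m$ also modulo equality a.e.). It induces an $L_2$-orthonormal system $(b_k)_{k\ge0}$, unique up to unimodular factors, with $V_m=\operatorname{span}\{b_k:0\le k<m\}$ for all $m\ge 1$. A function $f\in L_2$ has a *pointwise convergent Fourier series* if $$f(x)=\lim_{n\to\infty}\sum_{k=0}^{n-1}\langle f,b_k\rangle_2\,b_k(x)\qquad\text{for all }x\in D.$$ Put $d(f,V_k)_2:=\inf_{g\in V_k}\|f-g\|_2$. For points $x_1,\dots,x_n\in D$, weights $w_1,\dots,w_n>0$ and a finite-dimensional space $W$ of functions on $D$, the *weighted least squares algorithm* maps $f:D\to\mathbb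 C$ to a minimizer over $g\in W$ of $\sum_{i=1}^n w_i|f(x_i)-g(x_i)|^2$. **Theorem.** For every $\varepsilon>0$ there are a constant $C_\varepsilon>0$ depending only on $\varepsilon$, and constants $K_{\varepsilon,\alpha}>0$ depending only on $\varepsilon$ and $\alpha$, such that the following holds. Let $(D,\mu)$ be a measure space, let $(V_m)_{m\ge1}$ be a nested sequence of subspaces of $L_2(D,\mu)$, and let $m\ge1$. Then there exist $4m$ distinct points $x_1,\dots,x_{4m}\in D$ and weights $w_1,\dots,w_{4m}>0$ such that the least squares problem on $V_{2m}$ with these points and weights has a unique minimizer $A_mf\in V_{2m}$ for every $f:D\to\mathbb C$, and for every $f\in L_2$ with pointwise convergent Fourier series: 1. $$\|f-A_mf\|_2^2\le C_\varepsilon\, m^{-1-\varepsilon}\sum_{k>m}k^{\varepsilon}\,d(f,V_k)_2^2,$$ where the right-hand side may be infinite; 2. for every $\alpha>\tfrac12+\tfrac\varepsilon2$ and every $c>0$: if $d(f,V_k)_2\le c\,k^{-\alpha}$ for all $k\ge2$, then $\|f-A_mf\|_2\le K_{\varepsilon,\alpha}\,c\,m^{-\alpha}$. If, in addition, $\mu$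 is a probability measure and $V_m$ contains the constant functions, then the points and weights with all these properties can be chosen such that moreover $\|w\|_1=\sum_{i=1}^{4m}w_i\le 9$. -/

import Mathlib

open MeasureTheory Filter Topology
open scoped ENNReal ComplexConjugate

universe u

namespace SamplingApprox

/-- The `L₂` inner product of two square-integrable functions (as functions, not classes). -/
noncomputable def l2Inner {D : Type*} [MeasurableSpace D] (μ : Measure D) (f g : D → ℂ) : ℂ :=
  ∫ x, f x * conj (g x) ∂μ

/-- `V 1 ⊂ V 2 ⊂ ⋯` is a nested sequence of subspaces of `L₂(D, μ)`: each `V m`, `m ≥ 1`, is a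
space of square-integrable functions of dimension `m` in `L₂`. Function values matter, so `V m`
consists of functions and contains at most one representative of each `μ`-class.
The value `V 0` is irrelevant. -/
structure IsNestedL2 {D : Type*} [MeasurableSpace D] (μ : Measure D)
    (V : ℕ → Submodule ℂ (D → ℂ)) : Prop where
  memLp : ∀ m, 1 ≤ m → ∀ g ∈ V m, MemLp g 2 μ
  eq_zero_of_ae : ∀ m, 1 ≤ m → ∀ g ∈ V m, g =ᵐ[μ] 0 → g = 0
  finrank_eq : ∀ m, 1 ≤ m → Module.finrank ℂ (V m) = m
  le_succ : ∀ m, 1 ≤ m → V m ≤ V (m + 1)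

/-- `b 0, b 1, …` is an orthonormal system in `L₂(D, μ)` with
`V m = span {b k : 0 ≤ k < m}` for all `m ≥ 1`. (It is unique up to unimodular factors.) -/
structure IsInducedONS {D : Type*} [MeasurableSpace D] (μ : Measure D)
    (V : ℕ → Submodule ℂ (D → ℂ)) (b : ℕ → D → ℂ) : Prop where
  memLp : ∀ k, MemLp (b k) 2 μ
  orthonormal : ∀ j k, l2Inner μ (b j) (b k) = if j = k then 1 else 0
  span_eq : ∀ m, 1 ≤ m → V m = Submodule.span ℂ (b '' Set.Iio m)

/-- `f` equals, at every point of `D`, the limit of the partial sums of its Fourier series with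
respect to the orthonormal system induced by `V`. The terms `⟨f, b k⟩ b k x` do not change when
`b k` is multiplied by a unimodular factor, so the choice of the system does not matter. -/
def HasPointwiseFourierSeries {D : Type*} [MeasurableSpace D] (μ : Measure D)
    (V : ℕ → Submodule ℂ (D → ℂ)) (f : D → ℂ) : Prop :=
  ∃ b : ℕ → D → ℂ, IsInducedONS μ V b ∧
    ∀ x, Tendsto (fun n : ℕ => ∑ k ∈ Finset.range n, l2Inner μ f (b k) * b k x) atTop (𝓝 (f x))

/-- The error of best `L₂`-approximation, `d(f, W)₂ = inf {‖f - g‖₂ : g ∈ W}`. -/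
noncomputable def bestL2Error {D : Type*} [MeasurableSpace D] (μ : Measure D)
    (W : Submodule ℂ (D → ℂ)) (f : D → ℂ) : ℝ≥0∞ :=
  ⨅ g ∈ W, eLpNorm (f - g) 2 μ

/-- `g` minimizes `∑ i, w i * |f (x i) - g (x i)| ^ 2` over `W`. -/
def IsLeastSquaresFit {D : Type*} {n : ℕ} (x : Fin n → D) (w : Fin n → ℝ)
    (W : Submodule ℂ (D → ℂ)) (f g : D → ℂ) : Prop :=
  g ∈ W ∧ ∀ h ∈ W, ∑ i, w i * ‖f (x i) - g (x i)‖ ^ 2 ≤ ∑ i, w i * ‖f (x i) - h (x i)‖ ^ 2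

/-- The weighted least squares algorithm with points `x`, weights `w` and approximation space `W`:
`f` is mapped to the minimizer of the weighted empirical squared error over `W` (to be used only
where that minimizer is unique). -/
noncomputable def leastSquares {D : Type*} {n : ℕ} (x : Fin n → D) (w : Fin n → ℝ)
    (W : Submodule ℂ (D → ℂ)) (f : D → ℂ) : D → ℂ :=
  Classical.epsilon (IsLeastSquaresFit x w W f)

end SamplingApprox

open SamplingApprox

/-! Let `b` be an orthonormal system inducing the spaces. The vector `u x` of the conjugated values
of the first `2 * m` functions is isotropic: `∫ |⟪h, u⟫|² = ‖h‖²`. The `ℓ²` vector `v x` with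
entries `s k * conj (b k x)`, where `s k = (2m/k)^((1+ε)/2)` for `k ≥ 2m` and `0` before, is
sub-isotropic with `∫ ‖v‖² ≤ 1 + 2m/ε`. A two-sided Batson–Spielman–Srivastava barrier argument
finds at most `4 * m` weighted points giving at once a lower frame bound `m` for `u` and an upper
bound of order `m` for `v` (`exists_sparse_weights`). The tail lives in an infinite-dimensional
space, so the usual trace of the resolvent is replaced by `avgQuad`, the mean of the resolvent form
over `v`, which is finite because `v` is square integrable.

Let `g` be the Fourier partial sum of `f` of order `2m`. By pointwise convergence, `f - g` at a
sample point equals `⟪v x, h⟫` with `h k = ⟨f, b k⟩ / s k`, so its discrete norm is at most a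
constant times `√m ‖h‖`. Discrete projection does not increase this norm, and the lower frame bound
turns it into an `L₂` bound for the difference between the least squares fit and `g`
(`eLpNorm_sub_leastSquares_sq_le`).

It remains to bound `‖h‖² = ∑ (j/2m)^(1+ε) |⟨f, b j⟩|²` over `j ≥ 2m`. Since `(j/2)^(1+ε)` is at
most the sum of `k^ε` over `j/2 < k ≤ j`, exchanging sums and using Bessel's inequality gives the
stated weighted sum of squared distances (`tsum_weighted_le_tsum_tails`). Rescaling all weights
changes neither the fit nor the ratio of the two frame bounds, which takes care of `‖w‖₁`. -/

namespace SamplingApprox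

local notation "⟪" x ", " y "⟫" => inner ℂ x y

/-! ### Resolvent calculus and the two barrier steps in a Hilbert space -/

section Barrier

open InnerProductSpace

variable {H : Type*} [NormedAddCommGroup H] [InnerProductSpace ℂ H]

/-- `B` is a positive bounded operator with bounded inverse `R`. -/
structure IsPosInverse (B R : H →L[ℂ] H) : Prop where
  pos : B.IsPositive
  apply_right : ∀ h, B (R h) = h
  apply_left : ∀ h, R (B h) = h

namespace IsPosInverse

variable {B R : H →L[ℂ] H}

theorem inner_inv_left (hBR : IsPosInverse B R) (x y : H) : ⟪R x, y⟫ = ⟪x, R y⟫ := by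
  conv_lhs => rw [← hBR.apply_right y]
  rw [← hBR.pos.inner_left_eq_inner_right, hBR.apply_right]

theorem inv_nonneg (hBR : IsPosInverse B R) (h : H) : 0 ≤ R.reApplyInnerSelf h := by
  have := hBR.pos.re_inner_nonneg_right (R h)
  rwa [hBR.apply_right] at this

theorem inv_isPositive (hBR : IsPosInverse B R) : R.IsPositive :=
  ⟨fun x y => hBR.inner_inv_left x y, fun x => hBR.inv_nonneg x⟩

theorem inv_injective (hBR : IsPosInverse B R) {h : H} (h0 : R h = 0) : h = 0 := by
  rw [← hBR.apply_right h, h0, map_zero]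

/-- The resolvent identity. -/
theorem resolvent {B' R' : H →L[ℂ] H} (hBR : IsPosInverse B R) (hBR' : IsPosInverse B' R')
    {δ : ℝ} (hB : ∀ h, B' h = B h + (δ : ℂ) • h) (h : H) :
    R h = R' h + (δ : ℂ) • R (R' h) := by
  have := hB (R' h)
  rw [hBR'.apply_right] at this
  conv_lhs => rw [this]
  rw [map_add, map_smul, hBR.apply_left]

theorem resolvent' {B' R' : H →L[ℂ] H} (hBR : IsPosInverse B R) (hBR' : IsPosInverse B' R')
    {δ : ℝ} (hB : ∀ h, B' h = B h + (δ : ℂ) • h) (h : H) :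
    R h = R' h + (δ : ℂ) • R' (R h) := by
  have := hB (R h)
  rw [hBR.apply_right] at this
  have h2 : h = B' (R h) - (δ : ℂ) • R h := by rw [this]; abel
  have h3 : R' h = R h - (δ : ℂ) • R' (R h) := by
    conv_lhs => rw [h2]
    rw [map_sub, map_smul, hBR'.apply_left]
  rw [h3]; abel

theorem quad_sub {B' R' : H →L[ℂ] H} (hBR : IsPosInverse B R) (hBR' : IsPosInverse B' R')
    {δ : ℝ} (hB : ∀ h, B' h = B h + (δ : ℂ) • h) (h : H) :
    R.reApplyInnerSelf h - R'.reApplyInnerSelf h = δ * (⟪R' h, R h⟫).re := by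
  have h1 : ⟪R h, h⟫ = ⟪R' h, h⟫ + δ * ⟪R' h, R h⟫ := by
    conv_lhs => rw [hBR.resolvent hBR' hB h]
    rw [inner_add_left, inner_smul_left, hBR.inner_inv_left (R' h) h]
    simp
  simp [ContinuousLinearMap.reApplyInnerSelf, h1]

/-- The last term is nonnegative for `δ ≥ 0`, so the cross term dominates `‖R' h‖²`; with `quad_sub`
this makes the potential drop by at least `δ` times the mean of `‖R' v‖²`. -/
theorem re_inner_inv {B' R' : H →L[ℂ] H} (hBR : IsPosInverse B R) (hBR' : IsPosInverse B' R')
    {δ : ℝ} (hB : ∀ h, B' h = B h + (δ : ℂ) • h) (h : H) :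
    (⟪R' h, R h⟫).re = ‖R' h‖ ^ 2 + δ * R.reApplyInnerSelf (R' h) := by
  have h1 : ⟪R' h, R h⟫ = ⟪R' h, R' h⟫ + δ * ⟪R (R' h), R' h⟫ := by
    conv_lhs => rw [hBR.resolvent hBR' hB h]
    rw [inner_add_right, inner_smul_right, hBR.inner_inv_left (R' h) (R' h)]
  rw [h1, inner_self_eq_norm_sq_to_K]
  simp [ContinuousLinearMap.reApplyInnerSelf, ← Complex.ofReal_pow]

theorem norm_inv_sq {B' R' : H →L[ℂ] H} (hBR : IsPosInverse B R) (hBR' : IsPosInverse B' R')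
    {δ : ℝ} (hB : ∀ h, B' h = B h + (δ : ℂ) • h) (h : H) :
    ‖R h‖ ^ 2 = (⟪R' h, R h⟫).re + δ * R'.reApplyInnerSelf (R h) := by
  have h1 : ⟪R h, R h⟫ = ⟪R' h, R h⟫ + δ * ⟪R' (R h), R h⟫ := by
    conv_lhs => rw [hBR.resolvent' hBR' hB h]
    rw [inner_add_left, inner_smul_left, ← hBR.resolvent' hBR' hB h]
    simp
  rw [← inner_self_eq_norm_sq (𝕜 := ℂ), h1]
  simp [ContinuousLinearMap.reApplyInnerSelf]

/-- Lax–Milgram. In infinite dimensions strict positivity does not give a bounded inverse, so the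
barrier steps carry an explicit coercivity constant. -/
theorem exists_of_coercive [CompleteSpace H] (hB : B.IsPositive) {c : ℝ} (hc : 0 < c)
    (hcB : ∀ h, c * ‖h‖ ^ 2 ≤ B.reApplyInnerSelf h) : ∃ R, IsPosInverse B R := by
  have hu : IsUnit B := by
    refine ContinuousLinearMap.isUnit_of_forall_le_norm_inner_map B (c := ⟨c, hc.le⟩) hc
      fun x => ?_
    calc ‖x‖ ^ 2 * c = c * ‖x‖ ^ 2 := mul_comm _ _
      _ ≤ B.reApplyInnerSelf x := hcB x
      _ ≤ ‖⟪B x, x⟫‖ := Complex.re_le_norm _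
  obtain ⟨U, rfl⟩ := hu
  refine ⟨(U⁻¹ : (H →L[ℂ] H)ˣ).1, hB, fun h => ?_, fun h => ?_⟩
  · exact DFunLike.congr_fun U.mul_inv h
  · exact DFunLike.congr_fun U.inv_mul h

/-- Sherman–Morrison formula for the quadratic form of the inverse. -/
theorem quad_rankOne_update {R' : H →L[ℂ] H} {s : ℝ} {v : H} (hBR : IsPosInverse B R)
    (hBR' : IsPosInverse (B + (s : ℂ) • rankOne ℂ v v) R')
    (hs : 1 + s * R.reApplyInnerSelf v ≠ 0) (h : H) :
    R'.reApplyInnerSelf h =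
      R.reApplyInnerSelf h - s / (1 + s * R.reApplyInnerSelf v) * ‖⟪R v, h⟫‖ ^ 2 := by
  set q := R.reApplyInnerSelf v with hq
  have hqv : ⟪v, R v⟫ = (q : ℂ) := by
    rw [← hBR.inner_inv_left, hq]
    have := hBR.inv_isPositive.inner_nonneg_left v
    rw [Complex.nonneg_iff] at this
    apply Complex.ext
    · rfl
    · simpa using this.2.symm
  set y := R' h with hy
  have e1 : B y + ((s : ℂ) * ⟪v, y⟫) • v = h := by
    have := hBR'.apply_right h
    rw [mul_smul]; exact this
  have e2 : y = R h - ((s : ℂ) * ⟪v, y⟫) • R v := by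
    have : B y = h - ((s : ℂ) * ⟪v, y⟫) • v := by rw [← e1]; abel
    conv_lhs => rw [← hBR.apply_left y, this]
    rw [map_sub, map_smul]
  have hs' : (1 + (s : ℂ) * q) ≠ 0 := by exact_mod_cast hs
  have e3 : ⟪v, y⟫ = ⟪R v, h⟫ / (1 + (s : ℂ) * q) := by
    have : ⟪v, y⟫ = ⟪v, R h⟫ - (s : ℂ) * ⟪v, y⟫ * q := by
      conv_lhs => rw [e2]
      rw [inner_sub_right, inner_smul_right, hqv]
    rw [eq_div_iff hs', hBR.inner_inv_left]
    linear_combination this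
  have e4 : ⟪h, y⟫ = ⟪h, R h⟫ - ((s / (1 + s * q) * ‖⟪R v, h⟫‖ ^ 2 : ℝ) : ℂ) := by
    conv_lhs => rw [e2]
    rw [inner_sub_right, inner_smul_right, e3]
    have : ⟪h, R v⟫ = conj ⟪R v, h⟫ := (inner_conj_symm _ _).symm
    rw [this]
    have h5 : ⟪R v, h⟫ * conj ⟪R v, h⟫ = ((‖⟪R v, h⟫‖ ^ 2 : ℝ) : ℂ) := by
      rw [Complex.mul_conj, Complex.normSq_eq_norm_sq]
    push_cast at h5 ⊢
    rw [← h5]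
    ring
  have e5 : R'.reApplyInnerSelf h = (⟪h, y⟫).re := by
    rw [← hBR'.inner_inv_left]; rfl
  have e6 : R.reApplyInnerSelf h = (⟪h, R h⟫).re := by
    rw [← hBR.inner_inv_left]; rfl
  rw [e5, e4, e6, Complex.sub_re, Complex.ofReal_re]

/-- Cauchy–Schwarz for the form of `B`, evaluated at `R v`. -/
theorem norm_inner_sq_le (hBR : IsPosInverse B R) (v h : H) :
    ‖⟪v, h⟫‖ ^ 2 ≤ R.reApplyInnerSelf v * B.reApplyInnerSelf h := by
  set c := ⟪v, h⟫ with hc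
  -- The form of `B` at `conj c • h - t • R v` is nonnegative for all real `t`; the discriminant
  -- then gives the inequality up to a factor `‖c‖ ^ 2`, to be cancelled.
  have key : ∀ t : ℝ, 0 ≤ R.reApplyInnerSelf v * (t * t) +
      (-2 * ‖c‖ ^ 2) * t + ‖c‖ ^ 2 * B.reApplyInnerSelf h := by
    intro t
    have h1 := hBR.pos.re_inner_nonneg_left (conj c • h - (t : ℂ) • R v)
    have h2 : ⟪B (conj c • h - (t : ℂ) • R v), conj c • h - (t : ℂ) • R v⟫ =
        ((t * t : ℝ) : ℂ) * ⟪R v, v⟫ - ((2 * ‖c‖ ^ 2 * t : ℝ) : ℂ)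
          + ((‖c‖ ^ 2 : ℝ) : ℂ) * ⟪B h, h⟫ := by
      have hcc : c * conj c = ((‖c‖ ^ 2 : ℝ) : ℂ) := by
        rw [Complex.mul_conj, Complex.normSq_eq_norm_sq]
      have e1 : ⟪B h, R v⟫ = conj c := by
        rw [← hBR.inner_inv_left, hBR.apply_left, hc, inner_conj_symm]
      have e2 : ⟪v, R v⟫ = ⟪R v, v⟫ := (hBR.inner_inv_left _ _).symm
      simp only [map_sub, map_smul, inner_sub_left, inner_sub_right, inner_smul_left,
        inner_smul_right, hBR.apply_right, e1, e2, ← hc, Complex.conj_conj, Complex.conj_ofReal]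
      push_cast at hcc ⊢
      rw [← hcc]
      ring
    rw [h2] at h1
    simp only [ContinuousLinearMap.reApplyInnerSelf]
    simp only [RCLike.re_to_complex, Complex.add_re, Complex.sub_re, Complex.re_ofReal_mul,
      Complex.ofReal_re] at h1 ⊢
    linarith
  have hd := discrim_le_zero key
  unfold discrim at hd
  by_cases h0 : ‖c‖ ^ 2 = 0
  · rw [h0]
    exact mul_nonneg (hBR.inv_nonneg v) (hBR.pos.re_inner_nonneg_left h)
  · have : 0 < ‖c‖ ^ 2 := lt_of_le_of_ne (sq_nonneg _) (Ne.symm h0)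
    nlinarith

end IsPosInverse

variable {D : Type*} [MeasurableSpace D] {μ : Measure D}

/-- The trace of `T` against the covariance operator of the random vector `v`. -/
noncomputable def avgQuad (μ : Measure D) (v : D → H) (T : H →L[ℂ] H) : ℝ :=
  ∫ x, T.reApplyInnerSelf (v x) ∂μ

theorem integrable_re_inner_clm {v : D → H} (hv : MemLp v 2 μ) (S T : H →L[ℂ] H) :
    Integrable (fun x => (⟪S (v x), T (v x)⟫).re) μ := by
  have hS := S.comp_memLp' hv
  have hT := T.comp_memLp' hv
  refine Integrable.mono' (hS.norm.integrable_mul hT.norm) ?_ (ae_of_all _ fun x => ?_)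
  · exact Complex.measurable_re.comp_aemeasurable (hS.1.inner hT.1).aemeasurable
      |>.aestronglyMeasurable
  · exact (Complex.abs_re_le_norm _).trans (norm_inner_le_norm _ _)

theorem integrable_quad {v : D → H} (hv : MemLp v 2 μ) (T : H →L[ℂ] H) :
    Integrable (fun x => T.reApplyInnerSelf (v x)) μ :=
  integrable_re_inner_clm hv T (.id ℂ H)

theorem integrable_quad_comp {v : D → H} (hv : MemLp v 2 μ) (T S : H →L[ℂ] H) :
    Integrable (fun x => T.reApplyInnerSelf (S (v x))) μ :=
  integrable_re_inner_clm hv (T ∘L S) S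

theorem integrable_norm_sq_clm {v : D → H} (hv : MemLp v 2 μ) (T : H →L[ℂ] H) :
    Integrable (fun x => ‖T (v x)‖ ^ 2) μ :=
  (T.comp_memLp' hv).integrable_norm_pow two_ne_zero

theorem integrable_norm_inner_sq {v : D → H} (hv : MemLp v 2 μ) (h : H) :
    Integrable (fun x => ‖⟪h, v x⟫‖ ^ 2) μ :=
  ((innerSL ℂ h).comp_memLp' hv).integrable_norm_pow two_ne_zero

/-- Makes the change of potential in a barrier step strictly positive, so that it can serve as a
denominator. -/
theorem integral_norm_inv_sq_pos {v : D → H} (hv : MemLp v 2 μ) (hv0 : 0 < ∫ x, ‖v x‖ ^ 2 ∂μ)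
    {B R : H →L[ℂ] H} (hBR : IsPosInverse B R) : 0 < ∫ x, ‖R (v x)‖ ^ 2 ∂μ := by
  refine lt_of_le_of_ne (integral_nonneg fun _ => sq_nonneg _) fun h => ?_
  rw [eq_comm, integral_eq_zero_iff_of_nonneg (fun _ => sq_nonneg _)
    (integrable_norm_sq_clm hv R)] at h
  have : ∫ x, ‖v x‖ ^ 2 ∂μ = 0 := by
    refine (integral_eq_zero_iff_of_nonneg (fun _ => sq_nonneg _)
      (integrable_norm_sq_clm hv (.id ℂ H))).2 ?_
    filter_upwards [h] with x hx
    have : R (v x) = 0 := by simpa using hx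
    simp [hBR.inv_injective this]
  exact hv0.ne' this

theorem avgQuad_rankOne_update {v : D → H} (hv : MemLp v 2 μ) {B R R' : H →L[ℂ] H} {s : ℝ}
    {z : H} (hBR : IsPosInverse B R) (hBR' : IsPosInverse (B + (s : ℂ) • rankOne ℂ z z) R')
    (hs : 1 + s * R.reApplyInnerSelf z ≠ 0) :
    avgQuad μ v R' = avgQuad μ v R -
      s / (1 + s * R.reApplyInnerSelf z) * ∫ y, ‖⟪R z, v y⟫‖ ^ 2 ∂μ := by
  simp only [avgQuad]
  rw [← integral_const_mul, ← integral_sub (integrable_quad hv R)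
    ((integrable_norm_inner_sq hv _).const_mul _)]
  exact integral_congr_ae (ae_of_all _ fun y => hBR.quad_rankOne_update hBR' hs (v y))

theorem avgQuad_sub {v : D → H} (hv : MemLp v 2 μ) {B R B' R' : H →L[ℂ] H} {δ : ℝ}
    (hBR : IsPosInverse B R) (hBR' : IsPosInverse B' R')
    (hB : ∀ h, B' h = B h + (δ : ℂ) • h) :
    avgQuad μ v R - avgQuad μ v R' = δ * ∫ x, (⟪R' (v x), R (v x)⟫).re ∂μ := by
  rw [avgQuad, avgQuad, ← integral_sub (integrable_quad hv R) (integrable_quad hv R'),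
    ← integral_const_mul]
  exact integral_congr_ae (ae_of_all _ fun x => hBR.quad_sub hBR' hB (v x))

theorem isPositive_add_smul_id {B : H →L[ℂ] H} (hB : B.IsPositive) {δ : ℝ} (hδ : 0 ≤ δ) :
    (B + (δ : ℂ) • ContinuousLinearMap.id ℂ H).IsPositive :=
  hB.add (ContinuousLinearMap.isPositive_id.smul_of_nonneg (by exact_mod_cast hδ))

theorem quad_add_smul_id (B : H →L[ℂ] H) (δ : ℝ) (h : H) :
    (B + (δ : ℂ) • ContinuousLinearMap.id ℂ H).reApplyInnerSelf h =
      B.reApplyInnerSelf h + δ * ‖h‖ ^ 2 := by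
  have : ⟪(B + (δ : ℂ) • ContinuousLinearMap.id ℂ H) h, h⟫ = ⟪B h, h⟫ + δ * (‖h‖ ^ 2 : ℝ) := by
    rw [add_apply, inner_add_left, smul_apply, ContinuousLinearMap.id_apply, inner_smul_left,
      inner_self_eq_norm_sq_to_K]
    simp
  simp only [ContinuousLinearMap.reApplyInnerSelf, this, RCLike.re_to_complex, Complex.add_re,
    Complex.re_ofReal_mul, Complex.ofReal_re]

theorem quad_add_smul_rankOne (B : H →L[ℂ] H) (s : ℝ) (z h : H) :
    (B + (s : ℂ) • rankOne ℂ z z).reApplyInnerSelf h =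
      B.reApplyInnerSelf h + s * ‖⟪z, h⟫‖ ^ 2 := by
  have h5 : ⟪z, h⟫ * conj ⟪z, h⟫ = ((‖⟪z, h⟫‖ ^ 2 : ℝ) : ℂ) := by
    rw [Complex.mul_conj, Complex.normSq_eq_norm_sq]
  have : ⟪(B + (s : ℂ) • rankOne ℂ z z) h, h⟫ = ⟪B h, h⟫ + s * ((‖⟪z, h⟫‖ ^ 2 : ℝ) : ℂ) := by
    rw [← h5]
    simp only [add_apply, smul_apply, rankOne_apply,
      inner_add_left, inner_smul_left, Complex.conj_ofReal]
    ring
  simp only [ContinuousLinearMap.reApplyInnerSelf, this, RCLike.re_to_complex, Complex.add_re,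
    Complex.re_ofReal_mul, Complex.ofReal_re]

theorem isSymmetric_smul_rankOne (s : ℝ) (z : H) (x y : H) :
    ⟪((s : ℂ) • rankOne ℂ z z) x, y⟫ = ⟪x, ((s : ℂ) • rankOne ℂ z z) y⟫ := by
  simp only [smul_apply, rankOne_apply, inner_smul_left, inner_smul_right,
    Complex.conj_ofReal, inner_conj_symm]
  ring

theorem isPositive_of_coercive {B C : H →L[ℂ] H} (hB : B.IsPositive)
    (hC : ∀ x y, ⟪C x, y⟫ = ⟪x, C y⟫) {c : ℝ} (hc : 0 ≤ c)
    (h : ∀ x, c * ‖x‖ ^ 2 ≤ (B + C).reApplyInnerSelf x) : (B + C).IsPositive := by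
  refine ⟨fun x y => ?_, fun x => (mul_nonneg hc (sq_nonneg _)).trans (h x)⟩
  have h1 := hB.inner_left_eq_inner_right x y
  have h2 := hC x y
  change ⟪(B + C) x, y⟫ = ⟪x, (B + C) y⟫
  simp only [add_apply, inner_add_left, inner_add_right, h1, h2]

/-- One step of the upper barrier: the barrier moves up by `δ`, then `w v vᴴ` is subtracted. -/
theorem upper_barrier_step [CompleteSpace H] {v : D → H} (hv : MemLp v 2 μ)
    (hcov : ∀ h, ∫ y, ‖⟪h, v y⟫‖ ^ 2 ∂μ ≤ ‖h‖ ^ 2) (hv0 : 0 < ∫ x, ‖v x‖ ^ 2 ∂μ)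
    {B R : H →L[ℂ] H} (hBR : IsPosInverse B R) {δ : ℝ} (hδ : 0 < δ) :
    ∃ U : D → ℝ, (∀ x, 0 ≤ U x) ∧ Integrable U μ ∧ ∫ x, U x ∂μ ≤ avgQuad μ v R + 1 / δ ∧
      ∀ x (w : ℝ), 0 < w → U x < 1 / w → ∃ R', IsPosInverse
        (B + (δ : ℂ) • ContinuousLinearMap.id ℂ H + ((-w : ℝ) : ℂ) • rankOne ℂ (v x) (v x)) R' ∧
        avgQuad μ v R' ≤ avgQuad μ v R := by
  set B₁ := B + (δ : ℂ) • ContinuousLinearMap.id ℂ H with hB₁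
  have hB₁p : B₁.IsPositive := isPositive_add_smul_id hBR.pos hδ.le
  have hB₁c : ∀ h, δ * ‖h‖ ^ 2 ≤ B₁.reApplyInnerSelf h := fun h => by
    rw [hB₁, quad_add_smul_id]
    have := hBR.pos.re_inner_nonneg_left h
    change 0 ≤ B.reApplyInnerSelf h at this
    linarith
  obtain ⟨R₁, hR₁⟩ := IsPosInverse.exists_of_coercive hB₁p hδ hB₁c
  have hBB : ∀ h, B₁ h = B h + (δ : ℂ) • h := fun h => rfl
  set Δ := avgQuad μ v R - avgQuad μ v R₁ with hΔ
  have hz := integral_norm_inv_sq_pos hv hv0 hR₁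
  have hΔz : δ * ∫ x, ‖R₁ (v x)‖ ^ 2 ∂μ ≤ Δ := by
    rw [hΔ, avgQuad_sub hv hBR hR₁ hBB]
    refine mul_le_mul_of_nonneg_left ?_ hδ.le
    refine integral_mono (integrable_norm_sq_clm hv R₁) (integrable_re_inner_clm hv R₁ R)
      fun x => ?_
    dsimp only
    rw [hBR.re_inner_inv hR₁ hBB]
    have := mul_nonneg hδ.le (hBR.inv_nonneg (R₁ (v x)))
    linarith
  have hΔ0 : 0 < Δ := (mul_pos hδ hz).trans_le hΔz
  -- `w * U x < 1` says exactly that the potential gained by subtracting the rank-one term, at most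
  -- `w / (1 - w q) * ‖R₁ v‖²`, is less than the amount `Δ` gained by shifting. The mean of the
  -- second summand is at most `1 / δ` because `Δ ≥ δ ∫ ‖R₁ v‖²`.
  refine ⟨fun x => R₁.reApplyInnerSelf (v x) + ‖R₁ (v x)‖ ^ 2 / Δ, fun x => ?_, ?_, ?_, ?_⟩
  · exact add_nonneg (hR₁.inv_nonneg _) (by positivity)
  · exact (integrable_quad hv R₁).add ((integrable_norm_sq_clm hv R₁).div_const _)
  · rw [integral_add (integrable_quad hv R₁) ((integrable_norm_sq_clm hv R₁).div_const _),
      integral_div]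
    change avgQuad μ v R₁ + _ ≤ _
    have h1 : (∫ x, ‖R₁ (v x)‖ ^ 2 ∂μ) / Δ ≤ 1 / δ := by
      rw [div_le_div_iff₀ hΔ0 hδ]; linarith
    have : avgQuad μ v R₁ ≤ avgQuad μ v R := by linarith
    linarith
  · intro x w hw hUw
    set q := R₁.reApplyInnerSelf (v x) with hq
    have hq0 : 0 ≤ q := hR₁.inv_nonneg _
    have hn : 0 ≤ ‖R₁ (v x)‖ ^ 2 / Δ := by positivity
    have hwq : 0 < 1 - w * q := by
      have : q < 1 / w := by dsimp only at hUw; linarith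
      rw [lt_div_iff₀ hw] at this
      linarith
    -- Cauchy–Schwarz bounds the subtracted term by the fraction `w * q < 1` of the form of `B₁`.
    have hc : ∀ h, (1 - w * q) * δ * ‖h‖ ^ 2 ≤
        (B₁ + ((-w : ℝ) : ℂ) • rankOne ℂ (v x) (v x)).reApplyInnerSelf h := by
      intro h
      rw [quad_add_smul_rankOne]
      have h1 := hR₁.norm_inner_sq_le (v x) h
      have h2 := mul_le_mul_of_nonneg_left h1 hw.le
      have h3 := mul_le_mul_of_nonneg_left (hB₁c h) hwq.le
      rw [← hq] at h2
      linarith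
    have hpos := isPositive_of_coercive hB₁p (isSymmetric_smul_rankOne (-w) (v x))
      (mul_pos hwq hδ).le hc
    obtain ⟨R₂, hR₂⟩ := IsPosInverse.exists_of_coercive hpos (mul_pos hwq hδ) hc
    refine ⟨R₂, hR₂, ?_⟩
    have h1 : 1 + -w * q ≠ 0 := by linarith
    rw [avgQuad_rankOne_update hv hR₁ hR₂ h1, ← hq]
    have h2 := hcov (R₁ (v x))
    have h3 : w / (1 - w * q) * ‖R₁ (v x)‖ ^ 2 ≤ Δ := by
      dsimp only at hUw
      rw [lt_div_iff₀ hw] at hUw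
      have h4 : ‖R₁ (v x)‖ ^ 2 / Δ * w < 1 - w * q := by linarith
      rw [div_mul_eq_mul_div, div_lt_iff₀ hΔ0] at h4
      rw [div_mul_eq_mul_div, div_le_iff₀ hwq]
      linarith
    have h5 : w / (1 - w * q) * ∫ y, ‖⟪R₁ (v x), v y⟫‖ ^ 2 ∂μ ≤ Δ :=
      (mul_le_mul_of_nonneg_left h2 (by positivity)).trans h3
    have h6 : -w / (1 + -w * q) = -(w / (1 - w * q)) := by
      rw [neg_mul, ← sub_eq_add_neg, neg_div]
    rw [h6]
    linarith

/-- One step of the lower barrier: the barrier moves up by `δ`, then `w v vᴴ` is added. -/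
theorem lower_barrier_step [CompleteSpace H] {v : D → H} (hv : MemLp v 2 μ)
    (hcov : ∀ h, ∫ y, ‖⟪h, v y⟫‖ ^ 2 ∂μ = ‖h‖ ^ 2) (hv0 : 0 < ∫ x, ‖v x‖ ^ 2 ∂μ)
    {B R : H →L[ℂ] H} (hBR : IsPosInverse B R) {δ a : ℝ} (hδ : 0 < δ) (ha : δ < a)
    (hR : avgQuad μ v R ≤ 1 / a) :
    ∃ L : D → ℝ, Integrable L μ ∧ 1 / δ - avgQuad μ v R ≤ ∫ x, L x ∂μ ∧
      ∀ x (w : ℝ), 0 < w → 1 / w ≤ L x → ∃ R', IsPosInverse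
        (B + ((-δ : ℝ) : ℂ) • ContinuousLinearMap.id ℂ H + (w : ℂ) • rankOne ℂ (v x) (v x)) R' ∧
        avgQuad μ v R' ≤ avgQuad μ v R := by
  have ha0 : 0 < a := hδ.trans ha
  -- The potential controls the distance to the barrier: integrating `|⟪v y, h⟫|² ≤ ⟪R v, v⟫ ⟪B h,
  -- h⟫` over `y` and using isotropy gives `B ≥ a`, so the barrier can move by `δ < a`.
  have hBc : ∀ h, a * ‖h‖ ^ 2 ≤ B.reApplyInnerSelf h := by
    intro h
    have h1 : ‖h‖ ^ 2 ≤ avgQuad μ v R * B.reApplyInnerSelf h := by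
      rw [← hcov h, avgQuad, ← integral_mul_const]
      refine integral_mono (integrable_norm_inner_sq hv h) ((integrable_quad hv R).mul_const _)
        fun y => ?_
      dsimp only
      rw [norm_inner_symm]
      exact hBR.norm_inner_sq_le _ _
    have h2 : avgQuad μ v R * B.reApplyInnerSelf h ≤ 1 / a * B.reApplyInnerSelf h :=
      mul_le_mul_of_nonneg_right hR (hBR.pos.re_inner_nonneg_left h)
    have h3 := mul_le_mul_of_nonneg_left (h1.trans h2) ha0.le
    rwa [← mul_assoc, mul_one_div_cancel ha0.ne', one_mul] at h3
  set B₁ := B + ((-δ : ℝ) : ℂ) • ContinuousLinearMap.id ℂ H with hB₁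
  have haδ : 0 < a - δ := sub_pos.2 ha
  have hB₁c : ∀ h, (a - δ) * ‖h‖ ^ 2 ≤ B₁.reApplyInnerSelf h := fun h => by
    rw [hB₁, quad_add_smul_id]
    have := hBc h
    linarith
  have hB₁p : B₁.IsPositive := by
    refine isPositive_of_coercive hBR.pos (fun x y => ?_) haδ.le hB₁c
    rw [smul_apply, smul_apply, inner_smul_left, inner_smul_right, Complex.conj_ofReal]
    rfl
  obtain ⟨R₁, hR₁⟩ := IsPosInverse.exists_of_coercive hB₁p haδ hB₁c
  have hBB : ∀ h, B h = B₁ h + (δ : ℂ) • h := fun h => by simp [hB₁]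
  set Δ := avgQuad μ v R₁ - avgQuad μ v R with hΔ
  set y := ∫ x, (⟪R (v x), R₁ (v x)⟫).re ∂μ with hy
  set p := ∫ x, R.reApplyInnerSelf (R₁ (v x)) ∂μ with hp
  have hΔy : Δ = δ * y := avgQuad_sub hv hR₁ hBR hBB
  have hyz : (∫ x, ‖R₁ (v x)‖ ^ 2 ∂μ) = y + δ * p := by
    rw [hy, hp, ← integral_const_mul, ← integral_add (integrable_re_inner_clm hv R R₁)
      ((integrable_quad_comp hv R R₁).const_mul _)]
    exact integral_congr_ae (ae_of_all _ fun x => hR₁.norm_inv_sq hBR hBB (v x))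
  have hy0 : 0 < y := by
    refine (integral_norm_inv_sq_pos hv hv0 hBR).trans_le ?_
    refine integral_mono (integrable_norm_sq_clm hv R) (integrable_re_inner_clm hv R R₁)
      fun x => ?_
    dsimp only
    rw [hR₁.re_inner_inv hBR hBB]
    have := mul_nonneg hδ.le (hR₁.inv_nonneg (R (v x)))
    linarith
  have hΔ0 : 0 < Δ := hΔy ▸ mul_pos hδ hy0
  have hRδ : avgQuad μ v R ≤ 1 / δ := hR.trans (one_div_le_one_div_of_le hδ ha.le)
  have hp0 : 0 ≤ p := integral_nonneg fun x => hBR.inv_nonneg _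
  -- Cauchy–Schwarz for the semi-inner product `∫ ⟪R ·, ·⟫`, applied to `v` and `R₁ v`.
  have hcs : y ^ 2 ≤ avgQuad μ v R * p := by
    have key : ∀ t : ℝ, 0 ≤ p * (t * t) + (-2 * y) * t + avgQuad μ v R := by
      intro t
      have h1 : 0 ≤ ∫ x, R.reApplyInnerSelf (v x - (t : ℂ) • R₁ (v x)) ∂μ :=
        integral_nonneg fun x => hBR.inv_nonneg _
      have h2 : (fun x => R.reApplyInnerSelf (v x - (t : ℂ) • R₁ (v x))) =
          fun x => (t * t) * R.reApplyInnerSelf (R₁ (v x)) +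
            (-2 * t) * (⟪R (v x), R₁ (v x)⟫).re + R.reApplyInnerSelf (v x) := by
        funext x
        have e1 : (⟪R (R₁ (v x)), v x⟫).re = (⟪R (v x), R₁ (v x)⟫).re := by
          rw [hBR.inner_inv_left, ← inner_conj_symm]; exact Complex.conj_re _
        simp only [ContinuousLinearMap.reApplyInnerSelf, map_sub, map_smul, inner_sub_left,
          inner_sub_right, inner_smul_left, inner_smul_right, Complex.conj_ofReal,
          RCLike.re_to_complex, Complex.sub_re, Complex.re_ofReal_mul, e1]
        ring
      have i1 := (integrable_quad_comp hv R R₁).const_mul (t * t)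
      have i2 := (integrable_re_inner_clm hv R R₁).const_mul (-2 * t)
      have i3 : Integrable (fun x => t * t * R.reApplyInnerSelf (R₁ (v x)) +
          -2 * t * (⟪R (v x), R₁ (v x)⟫).re) μ := i1.add i2
      rw [h2, integral_add i3 (integrable_quad hv R), integral_add i1 i2,
        integral_const_mul, integral_const_mul] at h1
      change 0 ≤ t * t * p + -2 * t * y + avgQuad μ v R at h1
      linarith
    have hd := discrim_le_zero key
    unfold discrim at hd
    linarith
  -- `1 ≤ w * L x` says exactly that the Sherman–Morrison decrease `w / (1 + w q) * ‖R₁ v‖²` makes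
  -- up for the increase `Δ` caused by the shift.
  refine ⟨fun x => ‖R₁ (v x)‖ ^ 2 / Δ - R₁.reApplyInnerSelf (v x), ?_, ?_, ?_⟩
  · exact ((integrable_norm_sq_clm hv R₁).div_const _).sub (integrable_quad hv R₁)
  · rw [integral_sub ((integrable_norm_sq_clm hv R₁).div_const _) (integrable_quad hv R₁),
      integral_div, hyz]
    change _ ≤ _ - avgQuad μ v R₁
    have h1 : δ * y ^ 2 ≤ p := by
      have := mul_le_mul_of_nonneg_right hRδ hp0
      have h2 := mul_le_mul_of_nonneg_left (hcs.trans this) hδ.le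
      rwa [← mul_assoc, mul_one_div_cancel hδ.ne', one_mul] at h2
    -- The right side is `1 / δ + p / y`, and `h1` bounds `p / y` below by `δ y = Δ`, which cancels
    -- the growth of the potential under the shift.
    have h2 : 1 / δ + δ * y ≤ (y + δ * p) / Δ := by
      rw [hΔy, div_add' _ _ _ hδ.ne', div_le_div_iff₀ hδ (mul_pos hδ hy0)]
      have := mul_le_mul_of_nonneg_left h1 (mul_pos hδ hδ).le
      nlinarith
    linarith
  · intro x w hw hLw
    set q := R₁.reApplyInnerSelf (v x) with hq
    have hq0 : 0 ≤ q := hR₁.inv_nonneg _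
    have hc : ∀ h, (a - δ) * ‖h‖ ^ 2 ≤
        (B₁ + (w : ℂ) • rankOne ℂ (v x) (v x)).reApplyInnerSelf h := by
      intro h
      rw [quad_add_smul_rankOne]
      have h1 := hB₁c h
      have h2 : 0 ≤ w * ‖⟪v x, h⟫‖ ^ 2 := by positivity
      linarith
    have hpos := isPositive_of_coercive hB₁p (isSymmetric_smul_rankOne w (v x)) haδ.le hc
    obtain ⟨R₂, hR₂⟩ := IsPosInverse.exists_of_coercive hpos haδ hc
    refine ⟨R₂, hR₂, ?_⟩
    have hwq : 0 < 1 + w * q := by positivity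
    rw [avgQuad_rankOne_update hv hR₁ hR₂ hwq.ne', ← hq, hcov]
    have h3 : Δ ≤ w / (1 + w * q) * ‖R₁ (v x)‖ ^ 2 := by
      dsimp only at hLw
      rw [div_le_iff₀ hw] at hLw
      have h4 : 1 + w * q ≤ ‖R₁ (v x)‖ ^ 2 / Δ * w := by linarith
      rw [div_mul_eq_mul_div, le_div_iff₀ hΔ0] at h4
      rw [div_mul_eq_mul_div, le_div_iff₀ hwq]
      linarith
    linarith

end Barrier

/-! ### Sparsification by two simultaneous barriers -/

section Sparsification

theorem sum_add_single_mul {D : Type*} (W : D →₀ ℝ) (x : D) (w : ℝ) (F : D → ℝ) :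
    ((W + Finsupp.single x w).sum fun y c => c * F y) = (W.sum fun y c => c * F y) + w * F x := by
  classical
  rw [Finsupp.sum_add_index' (fun _ => zero_mul _) (fun _ _ _ => add_mul _ _ _),
    Finsupp.sum_single_index (zero_mul _)]

variable {D : Type*} [MeasurableSpace D] {μ : Measure D}

theorem exists_isPosInverse_smul_id {H : Type*} [NormedAddCommGroup H] [InnerProductSpace ℂ H]
    (v : D → H) {c : ℝ} (hc : 0 < c) : ∃ B R : H →L[ℂ] H, IsPosInverse B R ∧
      (∀ h, B.reApplyInnerSelf h = c * ‖h‖ ^ 2) ∧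
      avgQuad μ v R = (∫ x, ‖v x‖ ^ 2 ∂μ) / c := by
  have hq : ∀ (c : ℝ) (h : H),
      ((0 : H →L[ℂ] H) + (c : ℂ) • ContinuousLinearMap.id ℂ H).reApplyInnerSelf h =
        c * ‖h‖ ^ 2 := fun c h => by
    rw [quad_add_smul_id]
    simp [ContinuousLinearMap.reApplyInnerSelf]
  have hcc : (c : ℂ) ≠ 0 := by exact_mod_cast hc.ne'
  refine ⟨0 + (c : ℂ) • ContinuousLinearMap.id ℂ H,
    0 + ((c⁻¹ : ℝ) : ℂ) • ContinuousLinearMap.id ℂ H,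
    ⟨isPositive_add_smul_id ContinuousLinearMap.isPositive_zero hc.le, fun h => ?_, fun h => ?_⟩,
    hq c, ?_⟩
  · simp only [zero_add, smul_apply, ContinuousLinearMap.id_apply, smul_smul]
    push_cast
    rw [mul_inv_cancel₀ hcc, one_smul]
  · simp only [zero_add, smul_apply, ContinuousLinearMap.id_apply, smul_smul]
    push_cast
    rw [inv_mul_cancel₀ hcc, one_smul]
  · rw [avgQuad]
    simp_rw [hq]
    rw [integral_const_mul, div_eq_inv_mul]

/-- Simultaneous two-sided barrier argument (Batson–Spielman–Srivastava): `N` reweighted samples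
give a lower frame bound for the isotropic vector `u` and an upper bound for the sub-isotropic
vector `v`. -/
theorem exists_sparse_weights {H₁ H₂ : Type*} [NormedAddCommGroup H₁] [InnerProductSpace ℂ H₁]
    [CompleteSpace H₁] [NormedAddCommGroup H₂] [InnerProductSpace ℂ H₂] [CompleteSpace H₂]
    {u : D → H₁} {v : D → H₂} (hu : MemLp u 2 μ) (hv : MemLp v 2 μ)
    (hucov : ∀ h, ∫ y, ‖⟪h, u y⟫‖ ^ 2 ∂μ = ‖h‖ ^ 2)
    (hvcov : ∀ h, ∫ y, ‖⟪h, v y⟫‖ ^ 2 ∂μ ≤ ‖h‖ ^ 2)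
    (hu0 : 0 < ∫ x, ‖u x‖ ^ 2 ∂μ) (hv0 : 0 < ∫ x, ‖v x‖ ^ 2 ∂μ)
    {G : Set D} (hG : ∀ᵐ x ∂μ, x ∈ G) (N : ℕ) :
    ∃ W : D →₀ ℝ, W.support.card ≤ N ∧ (∀ x, 0 ≤ W x) ∧ (∀ x ∈ W.support, x ∈ G) ∧
      (∀ h, (N - 3 / 2 * ∫ x, ‖u x‖ ^ 2 ∂μ) * ‖h‖ ^ 2 ≤ W.sum fun x w => w * ‖⟪u x, h⟫‖ ^ 2) ∧
      ∀ h, (W.sum fun x w => w * ‖⟪v x, h⟫‖ ^ 2) ≤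
        (7 * (∫ x, ‖v x‖ ^ 2 ∂μ) + 7 * N) * ‖h‖ ^ 2 := by
  set n := ∫ x, ‖u x‖ ^ 2 ∂μ with hn
  set t := ∫ x, ‖v x‖ ^ 2 ∂μ with ht
  -- The lower barrier sits at `N - 3n/2` and the upper one at `7t + 7N`; the two `B` are the gaps
  -- to them. For `N = 0` the potentials equal `2/3` and `1/7`, and no step increases them.
  have key : ∃ W : D →₀ ℝ, W.support.card ≤ N ∧ (∀ x, 0 ≤ W x) ∧ (∀ x ∈ W.support, x ∈ G) ∧
      (∃ B R : H₁ →L[ℂ] H₁, IsPosInverse B R ∧ avgQuad μ u R ≤ 1 / (3 / 2) ∧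
        ∀ h, B.reApplyInnerSelf h =
          (W.sum fun x w => w * ‖⟪u x, h⟫‖ ^ 2) + (3 / 2 * n - N) * ‖h‖ ^ 2) ∧
      ∃ B R : H₂ →L[ℂ] H₂, IsPosInverse B R ∧ avgQuad μ v R ≤ 1 / 7 ∧
        ∀ h, B.reApplyInnerSelf h =
          (7 * t + 7 * N) * ‖h‖ ^ 2 - W.sum fun x w => w * ‖⟪v x, h⟫‖ ^ 2 := by
    induction N with
    | zero =>
      obtain ⟨B₁, R₁, h₁, hq₁, ha₁⟩ := exists_isPosInverse_smul_id (μ := μ) u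
        (c := 3 / 2 * n) (by positivity)
      obtain ⟨B₂, R₂, h₂, hq₂, ha₂⟩ := exists_isPosInverse_smul_id (μ := μ) v
        (c := 7 * t) (by positivity)
      refine ⟨0, by simp, by simp, by simp, ⟨B₁, R₁, h₁, ?_, fun h => ?_⟩,
        ⟨B₂, R₂, h₂, ?_, fun h => ?_⟩⟩
      · rw [ha₁, ← hn]; apply le_of_eq; field_simp
      · simp [hq₁]
      · rw [ha₂, ← ht]; apply le_of_eq; field_simp
      · simp [hq₂]
    | succ N ih =>
      obtain ⟨W, hcard, hW0, hWG, ⟨B₁, R₁, h₁, ha₁, hq₁⟩, ⟨B₂, R₂, h₂, ha₂, hq₂⟩⟩ := ih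
      -- With barrier speeds `1` and `7`, `∫ L ≥ 1 - 2/3 = 1/3`, whereas `∫ U ≤ 1/7 + 1/7 = 2/7`.
      -- Hence `U x < L x` at some `x ∈ G`, and the weight `1 / L x` is admissible for both
      -- barriers.
      obtain ⟨L, hLi, hL, hLstep⟩ := lower_barrier_step hu hucov hu0 h₁ (δ := 1) (a := 3 / 2)
        one_pos (by norm_num) ha₁
      obtain ⟨U, hU0, hUi, hU, hUstep⟩ := upper_barrier_step hv hvcov hv0 h₂ (δ := 7) (by norm_num)
      obtain ⟨x, hxG, hx⟩ : ∃ x ∈ G, U x < L x := by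
        by_contra! hcon
        have := integral_mono_ae hLi hUi (hG.mono fun x hx => hcon x hx)
        norm_num at ha₁ ha₂ hL hU
        linarith
      have hLx : 0 < L x := (hU0 x).trans_lt hx
      obtain ⟨R₁', hR₁', ha₁'⟩ := hLstep x (1 / L x) (by positivity) (by rw [one_div_one_div])
      obtain ⟨R₂', hR₂', ha₂'⟩ := hUstep x (1 / L x) (by positivity) (by rwa [one_div_one_div])
      classical
      refine ⟨W + Finsupp.single x (1 / L x), ?_, fun y => ?_, fun y hy => ?_,
        ⟨_, R₁', hR₁', ha₁'.trans ha₁, fun h => ?_⟩, ⟨_, R₂', hR₂', ha₂'.trans ha₂, fun h => ?_⟩⟩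
      · calc _ ≤ (W.support ∪ (Finsupp.single x (1 / L x)).support).card :=
              Finset.card_le_card Finsupp.support_add
          _ ≤ W.support.card + (Finsupp.single x (1 / L x)).support.card := Finset.card_union_le _ _
          _ ≤ N + 1 := by
              refine add_le_add hcard ?_
              exact (Finset.card_le_card Finsupp.support_single_subset).trans (by simp)
      · refine add_nonneg (hW0 y) ?_
        rw [Finsupp.single_apply]
        split_ifs <;> positivity
      · rcases Finset.mem_union.1 (Finsupp.support_add hy) with hy | hy
        · exact hWG y hy
        · rwa [Finset.mem_singleton.1 (Finsupp.support_single_subset hy)]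
      · rw [quad_add_smul_rankOne, quad_add_smul_id, hq₁, sum_add_single_mul]
        push_cast
        ring
      · rw [quad_add_smul_rankOne, quad_add_smul_id, hq₂, sum_add_single_mul]
        push_cast
        ring
  obtain ⟨W, hcard, hW0, hWG, ⟨B₁, R₁, h₁, -, hq₁⟩, ⟨B₂, R₂, h₂, -, hq₂⟩⟩ := key
  refine ⟨W, hcard, hW0, hWG, fun h => ?_, fun h => ?_⟩
  · have := h₁.pos.re_inner_nonneg_left h
    change 0 ≤ B₁.reApplyInnerSelf h at this
    rw [hq₁] at this
    linarith
  · have := h₂.pos.re_inner_nonneg_left h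
    change 0 ≤ B₂.reApplyInnerSelf h at this
    rw [hq₂] at this
    linarith

end Sparsification

/-! ### The induced orthonormal system, Bessel's inequality and Fourier terms -/

section OrthonormalSystem

variable {D : Type*} [MeasurableSpace D] {μ : Measure D}

theorem l2Inner_eq_inner {f g : D → ℂ} (hf : MemLp f 2 μ) (hg : MemLp g 2 μ) :
    l2Inner μ f g = ⟪hg.toLp g, hf.toLp f⟫ := by
  rw [L2.inner_def, l2Inner]
  refine integral_congr_ae ?_
  filter_upwards [hf.coeFn_toLp, hg.coeFn_toLp] with x h1 h2
  rw [h1, h2]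
  simp

theorem l2Inner_self {f : D → ℂ} (hf : MemLp f 2 μ) :
    l2Inner μ f f = ((‖hf.toLp f‖ ^ 2 : ℝ) : ℂ) := by
  rw [l2Inner_eq_inner hf hf, inner_self_eq_norm_sq_to_K]
  simp

theorem l2Inner_conj_symm {f g : D → ℂ} (hf : MemLp f 2 μ) (hg : MemLp g 2 μ) :
    conj (l2Inner μ f g) = l2Inner μ g f := by
  rw [l2Inner_eq_inner hf hg, l2Inner_eq_inner hg hf, inner_conj_symm]

theorem l2Inner_sub_left {f f' g : D → ℂ} (hf : MemLp f 2 μ) (hf' : MemLp f' 2 μ)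
    (hg : MemLp g 2 μ) : l2Inner μ (f - f') g = l2Inner μ f g - l2Inner μ f' g := by
  rw [l2Inner_eq_inner (hf.sub hf') hg, l2Inner_eq_inner hf hg, l2Inner_eq_inner hf' hg,
    MemLp.toLp_sub hf hf', inner_sub_right]

theorem l2Inner_smul_left (c : ℂ) (f g : D → ℂ) : l2Inner μ (c • f) g = c * l2Inner μ f g := by
  simp only [l2Inner, Pi.smul_apply, smul_eq_mul, mul_assoc]
  exact integral_const_mul _ _

theorem l2Inner_smul_right (c : ℂ) (f g : D → ℂ) :
    l2Inner μ f (c • g) = conj c * l2Inner μ f g := by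
  rw [l2Inner, l2Inner, ← integral_const_mul]
  refine integral_congr_ae (ae_of_all _ fun x => ?_)
  simp only [Pi.smul_apply, smul_eq_mul, map_mul]
  ring

/-- Fatou's lemma; it transfers norm bounds from partial sums to pointwise limits without proving
`L₂` convergence. -/
theorem eLpNorm_le_of_tendsto_ae {F : ℕ → D → ℂ} (hF : ∀ n, AEStronglyMeasurable (F n) μ)
    {f : D → ℂ} (hlim : ∀ᵐ x ∂μ, Tendsto (fun n => F n x) atTop (𝓝 (f x))) {c : ℝ≥0∞}
    (hc : ∀ᶠ n in atTop, eLpNorm (F n) 2 μ ≤ c) : eLpNorm f 2 μ ≤ c :=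
  (Lp.eLpNorm_lim_le_liminf_eLpNorm hF f hlim).trans (liminf_le_of_frequently_le' hc.frequently)

theorem integral_norm_sq_eq_eLpNorm {E : Type*} [NormedAddCommGroup E] {f : D → E}
    (hf : MemLp f 2 μ) : ENNReal.ofReal (∫ x, ‖f x‖ ^ 2 ∂μ) = eLpNorm f 2 μ ^ 2 := by
  rw [ofReal_integral_eq_lintegral_ofReal (hf.integrable_norm_pow two_ne_zero)
    (ae_of_all _ fun x => by positivity), eLpNorm_eq_lintegral_rpow_enorm_toReal two_ne_zero
    ENNReal.ofNat_ne_top, ← ENNReal.rpow_natCast, ← ENNReal.rpow_mul]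
  simp [← ofReal_norm, ENNReal.ofReal_pow]

namespace IsInducedONS

variable {V : ℕ → Submodule ℂ (D → ℂ)} {b : ℕ → D → ℂ}

/-- The orthonormal system as a sequence in `Lp`. -/
noncomputable def toL2 (hb : IsInducedONS μ V b) (k : ℕ) : Lp ℂ 2 μ := (hb.memLp k).toLp (b k)

theorem orthonormal_toL2 (hb : IsInducedONS μ V b) : Orthonormal ℂ hb.toL2 := by
  classical
  rw [orthonormal_iff_ite]
  intro j k
  rw [toL2, toL2, ← l2Inner_eq_inner (hb.memLp k) (hb.memLp j), hb.orthonormal]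
  simp [eq_comm]

theorem memLp_sum (hb : IsInducedONS μ V b) (s : Finset ℕ) (c : ℕ → ℂ) :
    MemLp (∑ k ∈ s, c k • b k) 2 μ :=
  memLp_finsetSum' s fun k _ => (hb.memLp k).const_smul (c k)

theorem toLp_sum (hb : IsInducedONS μ V b) (s : Finset ℕ) (c : ℕ → ℂ) :
    (hb.memLp_sum s c).toLp _ = ∑ k ∈ s, c k • hb.toL2 k := by
  classical
  induction s using Finset.induction_on with
  | empty => simp
  | insert a s ha ih =>
    rw [Finset.sum_insert (f := fun k => c k • hb.toL2 k) ha, ← ih, toL2,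
      ← MemLp.toLp_const_smul, ← MemLp.toLp_add]
    exact MemLp.toLp_congr _ _ (by rw [Finset.sum_insert ha])

theorem norm_sq_sum (hb : IsInducedONS μ V b) (s : Finset ℕ) (c : ℕ → ℂ) :
    ‖(hb.memLp_sum s c).toLp _‖ ^ 2 = ∑ k ∈ s, ‖c k‖ ^ 2 := by
  rw [hb.toLp_sum, ← inner_self_eq_norm_sq (𝕜 := ℂ), hb.orthonormal_toL2.inner_sum, map_sum]
  refine Finset.sum_congr rfl fun k _ => ?_
  rw [← Complex.normSq_eq_conj_mul_self, Complex.normSq_eq_norm_sq]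
  exact Complex.ofReal_re _

theorem eLpNorm_sq_sum (hb : IsInducedONS μ V b) (s : Finset ℕ) (c : ℕ → ℂ) :
    eLpNorm (∑ k ∈ s, c k • b k) 2 μ ^ 2 = ENNReal.ofReal (∑ k ∈ s, ‖c k‖ ^ 2) := by
  rw [← hb.norm_sq_sum, Lp.norm_toLp, ENNReal.ofReal_pow ENNReal.toReal_nonneg,
    ENNReal.ofReal_toReal (hb.memLp_sum s c).2.ne]

theorem l2Inner_sum (hb : IsInducedONS μ V b) (s : Finset ℕ) (c : ℕ → ℂ) (j : ℕ) :
    l2Inner μ (∑ k ∈ s, c k • b k) (b j) = if j ∈ s then c j else 0 := by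
  rw [l2Inner_eq_inner (hb.memLp_sum s c) (hb.memLp j), hb.toLp_sum]
  change ⟪hb.toL2 j, _⟫ = _
  split_ifs with h
  · exact hb.orthonormal_toL2.inner_right_sum c h
  · rw [inner_sum]
    refine Finset.sum_eq_zero fun k hk => ?_
    have : j ≠ k := fun hjk => h (hjk ▸ hk)
    rw [inner_smul_right, hb.orthonormal_toL2.2 this, mul_zero]

theorem bessel (hb : IsInducedONS μ V b) {f : D → ℂ} (hf : MemLp f 2 μ) (s : Finset ℕ) :
    ENNReal.ofReal (∑ k ∈ s, ‖l2Inner μ f (b k)‖ ^ 2) ≤ eLpNorm f 2 μ ^ 2 := by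
  have h := hb.orthonormal_toL2.sum_inner_products_le (s := s) (hf.toLp f)
  have h2 : eLpNorm f 2 μ ^ 2 = ENNReal.ofReal (‖hf.toLp f‖ ^ 2) := by
    rw [Lp.norm_toLp, ENNReal.ofReal_pow ENNReal.toReal_nonneg, ENNReal.ofReal_toReal hf.2.ne]
  rw [h2]
  refine ENNReal.ofReal_le_ofReal (le_trans (le_of_eq ?_) h)
  exact Finset.sum_congr rfl fun k _ => by rw [l2Inner_eq_inner hf (hb.memLp k)]; rfl

theorem mem_of_lt (hb : IsInducedONS μ V b) {k m : ℕ} (h : k < m) : b k ∈ V m := by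
  rw [hb.span_eq m (by omega)]
  exact Submodule.subset_span ⟨k, h, rfl⟩

theorem sum_mem (hb : IsInducedONS μ V b) {m : ℕ} (c : ℕ → ℂ) :
    ∑ k ∈ Finset.range m, c k • b k ∈ V m :=
  Submodule.sum_mem _ fun _ hk => Submodule.smul_mem _ _ (hb.mem_of_lt (Finset.mem_range.1 hk))

theorem exists_coeff (hb : IsInducedONS μ V b) {m : ℕ} (hm : 1 ≤ m) {g : D → ℂ} (hg : g ∈ V m) :
    ∃ c : ℕ → ℂ, g = ∑ k ∈ Finset.range m, c k • b k := by
  rw [hb.span_eq m hm, show Set.Iio m = (Finset.range m : Set ℕ) by simp,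
    Submodule.mem_span_image_finset_iff_exists_fun'] at hg
  obtain ⟨c, hc⟩ := hg
  exact ⟨c, hc.symm⟩

theorem l2Inner_eq_zero (hb : IsInducedONS μ V b) {m k : ℕ} (hm : 1 ≤ m) (hk : m ≤ k)
    {g : D → ℂ} (hg : g ∈ V m) : l2Inner μ g (b k) = 0 := by
  obtain ⟨c, rfl⟩ := hb.exists_coeff hm hg
  rw [hb.l2Inner_sum, if_neg (by simpa using hk)]

theorem eq_sum (hb : IsInducedONS μ V b) {m : ℕ} (hm : 1 ≤ m) {g : D → ℂ} (hg : g ∈ V m) :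
    g = ∑ k ∈ Finset.range m, l2Inner μ g (b k) • b k := by
  obtain ⟨c, rfl⟩ := hb.exists_coeff hm hg
  refine Finset.sum_congr rfl fun k hk => ?_
  rw [hb.l2Inner_sum, if_pos hk]

/-- The terms of a Fourier series do not depend on the choice of the orthonormal system. -/
theorem fourier_term_eq {b' : ℕ → D → ℂ} (hb : IsInducedONS μ V b) (hb' : IsInducedONS μ V b')
    (f : D → ℂ) (k : ℕ) : l2Inner μ f (b' k) • b' k = l2Inner μ f (b k) • b k := by
  -- In the expansion of `b' k ∈ V (k + 1)` only the last term survives, since `b' k` is orthogonal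
  -- to each `b j` with `j < k`.
  have h1 : b' k = l2Inner μ (b' k) (b k) • b k := by
    conv_lhs => rw [hb.eq_sum (Nat.succ_pos k) (hb'.mem_of_lt (Nat.lt_succ_self k))]
    rw [Finset.sum_range_succ, Finset.sum_eq_zero, zero_add]
    intro j hj
    have : l2Inner μ (b j) (b' k) = 0 :=
      hb'.l2Inner_eq_zero (Nat.succ_pos j) (Finset.mem_range.1 hj) (hb.mem_of_lt (Nat.lt_succ_self j))
    rw [← l2Inner_conj_symm (hb.memLp j) (hb'.memLp k), this, map_zero, zero_smul]
  set a := l2Inner μ (b' k) (b k)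
  have h2 : a * conj a = 1 := by
    have := hb'.orthonormal k k
    rwa [h1, l2Inner_smul_left, l2Inner_smul_right, hb.orthonormal, if_pos rfl, mul_one] at this
  rw [h1, l2Inner_smul_right, smul_smul]
  congr 1
  linear_combination l2Inner μ f (b k) * h2

/-- Bessel's inequality for the distance to `V m`. -/
theorem sum_le_bestL2Error_sq (hb : IsInducedONS μ V b) {f : D → ℂ} (hf : MemLp f 2 μ) {m : ℕ}
    (hm : 1 ≤ m) (n : ℕ) :
    ENNReal.ofReal (∑ k ∈ Finset.Ico m n, ‖l2Inner μ f (b k)‖ ^ 2) ≤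
      bestL2Error μ (V m) f ^ 2 := by
  have h : ENNReal.ofReal (√(∑ k ∈ Finset.Ico m n, ‖l2Inner μ f (b k)‖ ^ 2)) ≤
      bestL2Error μ (V m) f := by
    refine le_iInf₂ fun g hg => ?_
    have hgL : MemLp g 2 μ := by
      obtain ⟨c, rfl⟩ := hb.exists_coeff hm hg
      exact hb.memLp_sum _ _
    have h1 := hb.bessel (hf.sub hgL) (Finset.Ico m n)
    have h2 : ∑ k ∈ Finset.Ico m n, ‖l2Inner μ (f - g) (b k)‖ ^ 2 =
        ∑ k ∈ Finset.Ico m n, ‖l2Inner μ f (b k)‖ ^ 2 := by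
      refine Finset.sum_congr rfl fun k hk => ?_
      rw [l2Inner_sub_left hf hgL (hb.memLp k),
        hb.l2Inner_eq_zero hm (Finset.mem_Ico.1 hk).1 hg, sub_zero]
    rw [h2] at h1
    rw [← ENNReal.pow_le_pow_left_iff two_ne_zero, ← ENNReal.ofReal_pow (Real.sqrt_nonneg _),
      Real.sq_sqrt (Finset.sum_nonneg fun _ _ => sq_nonneg _)]
    exact h1
  calc _ = ENNReal.ofReal (√(∑ k ∈ Finset.Ico m n, ‖l2Inner μ f (b k)‖ ^ 2)) ^ 2 := by
        rw [← ENNReal.ofReal_pow (Real.sqrt_nonneg _),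
          Real.sq_sqrt (Finset.sum_nonneg fun _ _ => sq_nonneg _)]
    _ ≤ _ := by gcongr

end IsInducedONS

end OrthonormalSystem

/-! ### Gram–Schmidt in spaces of functions -/

section Existence

variable {D : Type*} [MeasurableSpace D] {μ : Measure D}

/-- Orthogonal complements inside spaces of functions: a proper inclusion `W < W'` leaves room for
a unit vector of `W'` orthogonal to `W`. -/
theorem exists_unit_orthogonal {W W' : Submodule ℂ (D → ℂ)} [FiniteDimensional ℂ W]
    (hlt : W < W') (hL : ∀ g ∈ W', MemLp g 2 μ) (h0 : ∀ g ∈ W', g =ᵐ[μ] 0 → g = 0) :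
    ∃ e ∈ W', l2Inner μ e e = 1 ∧ ∀ g ∈ W, l2Inner μ g e = 0 := by
  let T : W →ₗ[ℂ] Lp ℂ 2 μ :=
    { toFun := fun g => (hL g (hlt.le g.2)).toLp g
      map_add' := fun _ _ => rfl
      map_smul' := fun _ _ => rfl }
  obtain ⟨g₀, hg₀, hg₀W⟩ := Set.exists_of_ssubset hlt
  set K := LinearMap.range T
  -- The projection is taken among classes, but lies in the range of `T` and so has a representative
  -- in `W`; this keeps the new vector a genuine element of `W'`.
  obtain ⟨g₁, hg₁⟩ : K.starProjection ((hL g₀ hg₀).toLp g₀) ∈ K :=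
    Submodule.starProjection_apply_mem _ _
  have hmem : g₀ - (g₁ : D → ℂ) ∈ W' := W'.sub_mem hg₀ (hlt.le g₁.2)
  have hort : ∀ g ∈ W, l2Inner μ g (g₀ - (g₁ : D → ℂ)) = 0 := by
    intro g hg
    rw [l2Inner_eq_inner (hL g (hlt.le hg)) (hL _ hmem),
      MemLp.toLp_sub (hL g₀ hg₀) (hL g₁ (hlt.le g₁.2))]
    change ⟪_ - T g₁, T ⟨g, hg⟩⟫ = 0
    rw [hg₁]
    exact Submodule.starProjection_inner_eq_zero _ _ ⟨_, rfl⟩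
  have hne : (g₀ - g₁ : D → ℂ) ≠ 0 := fun h => hg₀W (by rw [sub_eq_zero.1 h]; exact g₁.2)
  set r := ‖(hL _ hmem).toLp (g₀ - (g₁ : D → ℂ))‖ with hr
  have hr0 : r ≠ 0 := by
    rw [hr, norm_ne_zero_iff]
    exact fun h => hne (h0 _ hmem ((hL _ hmem).coeFn_toLp.symm.trans
      ((Lp.eq_zero_iff_ae_eq_zero).1 h)))
  have hrc : (r : ℂ) ≠ 0 := by exact_mod_cast hr0
  refine ⟨(r : ℂ)⁻¹ • (g₀ - (g₁ : D → ℂ)), W'.smul_mem _ hmem, ?_, fun g hg => ?_⟩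
  · rw [l2Inner_smul_left, l2Inner_smul_right, l2Inner_self (hL _ hmem), ← hr, map_inv₀,
      Complex.conj_ofReal]
    push_cast
    field_simp
  · rw [l2Inner_smul_right, hort g hg, mul_zero]

theorem IsNestedL2.exists_isInducedONS {V : ℕ → Submodule ℂ (D → ℂ)} (hV : IsNestedL2 μ V) :
    ∃ b, IsInducedONS μ V b := by
  -- `V 0` is arbitrary, so the flag is made to start at `⊥`.
  let W : ℕ → Submodule ℂ (D → ℂ) := fun m => if m = 0 then ⊥ else V m
  have hW : ∀ m, 1 ≤ m → W m = V m := fun m hm => if_neg (by omega)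
  have hW0 : W 0 = ⊥ := if_pos rfl
  have hfin : ∀ m, FiniteDimensional ℂ (W m) := by
    intro m
    rcases Nat.eq_zero_or_pos m with rfl | hm
    · rw [hW0]; infer_instance
    · rw [hW m hm]
      exact Module.finite_of_finrank_pos (by rw [hV.finrank_eq m hm]; exact hm)
  have hrank : ∀ m, Module.finrank ℂ (W m) = m := by
    intro m
    rcases Nat.eq_zero_or_pos m with rfl | hm
    · rw [hW0]; exact finrank_bot ℂ _
    · rw [hW m hm, hV.finrank_eq m hm]
  have hle : Monotone W := by
    refine monotone_nat_of_le_succ fun m => ?_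
    rcases Nat.eq_zero_or_pos m with rfl | hm
    · rw [hW0]; exact bot_le
    · rw [hW m hm, hW (m + 1) (by omega)]
      exact hV.le_succ m hm
  have hlt : ∀ m, W m < W (m + 1) := fun m => by
    refine lt_of_le_of_ne (hle (Nat.le_succ m)) fun h => ?_
    have := hrank (m + 1)
    rw [← h, hrank m] at this
    omega
  have hex : ∀ m, ∃ e ∈ W (m + 1), l2Inner μ e e = 1 ∧ ∀ g ∈ W m, l2Inner μ g e = 0 := fun m => by
    have := hfin m
    refine exists_unit_orthogonal (hlt m) (fun g hg => ?_) fun g hg => ?_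
    · rw [hW _ (by omega)] at hg; exact hV.memLp _ (by omega) g hg
    · rw [hW _ (by omega)] at hg; exact hV.eq_zero_of_ae _ (by omega) g hg
  choose b hbW hb1 hb0 using hex
  have hbL : ∀ k, MemLp (b k) 2 μ := fun k =>
    hV.memLp (k + 1) (by omega) _ (by rw [← hW _ (by omega)]; exact hbW k)
  have hlt0 : ∀ j k, j < k → l2Inner μ (b j) (b k) = 0 := fun j k hjk =>
    hb0 k _ (hle hjk (hbW j))
  have hspan : ∀ m, W m = Submodule.span ℂ (b '' Set.Iio m) := by
    intro m
    induction m with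
    | zero => simp [hW0]
    | succ m ih =>
      have h1 : Submodule.span ℂ (b '' Set.Iio (m + 1)) ≤ W (m + 1) := by
        rw [Submodule.span_le]
        rintro _ ⟨k, hk, rfl⟩
        exact hle (Nat.succ_le_of_lt hk) (hbW k)
      -- The inclusion is strict because `b m` is a unit vector orthogonal to `W m`; counting
      -- dimensions then forces the span to be all of `W (m + 1)`.
      have h2 : W m < Submodule.span ℂ (b '' Set.Iio (m + 1)) := by
        refine lt_of_le_of_ne ?_ fun h => ?_
        · rw [ih]
          exact Submodule.span_mono (Set.image_mono (Set.Iio_subset_Iio (Nat.le_succ m)))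
        · have hm : b m ∈ W m := by
            rw [h]; exact Submodule.subset_span ⟨m, Nat.lt_succ_self m, rfl⟩
          have := hb0 m _ hm
          rw [hb1 m] at this
          exact one_ne_zero this
      have := hfin (m + 1)
      have : FiniteDimensional ℂ (Submodule.span ℂ (b '' Set.Iio (m + 1))) :=
        Submodule.finiteDimensional_of_le h1
      have h3 := Submodule.finrank_lt_finrank_of_lt h2
      refine (Submodule.eq_of_le_of_finrank_le h1 ?_).symm
      rw [hrank m] at h3
      rw [hrank]
      omega
  refine ⟨b, hbL, fun j k => ?_, fun m hm => by rw [← hW m hm, hspan]⟩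
  rcases lt_trichotomy j k with h | rfl | h
  · rw [if_neg h.ne, hlt0 j k h]
  · rw [if_pos rfl, hb1]
  · rw [if_neg h.ne', ← l2Inner_conj_symm (hbL k) (hbL j), hlt0 k j h, map_zero]

end Existence

/-! ### The random vectors `u` and `v` -/

namespace IsInducedONS

variable {D : Type*} [MeasurableSpace D] {μ : Measure D}
variable {V : ℕ → Submodule ℂ (D → ℂ)} {b : ℕ → D → ℂ}

theorem integral_norm_sq_sum (hb : IsInducedONS μ V b) (s : Finset ℕ) (c : ℕ → ℂ) :
    ∫ x, ‖∑ k ∈ s, c k * b k x‖ ^ 2 ∂μ = ∑ k ∈ s, ‖c k‖ ^ 2 := by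
  have h := integral_norm_sq_eq_eLpNorm (hb.memLp_sum s c)
  rw [hb.eLpNorm_sq_sum, ENNReal.ofReal_eq_ofReal_iff (integral_nonneg fun _ => sq_nonneg _)
    (Finset.sum_nonneg fun _ _ => sq_nonneg _)] at h
  simpa using h

theorem integral_norm_sq (hb : IsInducedONS μ V b) (k : ℕ) : ∫ x, ‖b k x‖ ^ 2 ∂μ = 1 := by
  simpa using hb.integral_norm_sq_sum {k} 1

/-- The vector of the first `n` basis functions, conjugated so that pairing it with coefficients
evaluates the corresponding function. -/
theorem exists_evalVec (hb : IsInducedONS μ V b) (n : ℕ) :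
    ∃ u : D → EuclideanSpace ℂ (Fin n), MemLp u 2 μ ∧
      (∀ x (c : ℕ → ℂ), ⟪u x, WithLp.toLp 2 fun k : Fin n => c k⟫ =
        ∑ k ∈ Finset.range n, c k * b k x) ∧
      (∀ h, ∫ y, ‖⟪h, u y⟫‖ ^ 2 ∂μ = ‖h‖ ^ 2) ∧ ∫ y, ‖u y‖ ^ 2 ∂μ = n := by
  have hval : ∀ x (h : EuclideanSpace ℂ (Fin n)),
      ⟪(WithLp.toLp 2 fun k : Fin n => conj (b k x) : EuclideanSpace ℂ (Fin n)), h⟫ =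
        ∑ k, h k * b k x := fun x h => by
    simp [PiLp.inner_apply]
  refine ⟨fun x => WithLp.toLp 2 fun k : Fin n => conj (b k x), ?_, fun x c => ?_, fun h => ?_, ?_⟩
  · have : (fun x => (WithLp.toLp 2 fun k : Fin n => conj (b k x) : EuclideanSpace ℂ (Fin n))) =
        fun x => ∑ k : Fin n, conj (b k x) • EuclideanSpace.single k (1 : ℂ) := by
      funext x
      ext j
      simp [Finset.sum_apply, Pi.single_apply]
    rw [this]
    refine memLp_finsetSum _ fun k _ => ?_
    exact ((ContinuousLinearMap.toSpanSingleton ℂ (EuclideanSpace.single k (1 : ℂ))).comp_memLp'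
      (hb.memLp k).star :)
  · rw [hval, Finset.sum_range]
  · set c : ℕ → ℂ := fun k => if hk : k < n then h ⟨k, hk⟩ else 0 with hc
    have hck : ∀ k : Fin n, h k = c k := fun k => by simp [hc]
    have := hb.integral_norm_sq_sum (Finset.range n) c
    rw [EuclideanSpace.norm_sq_eq]
    simp_rw [norm_inner_symm h, hval, hck]
    rw [Finset.sum_range] at this
    simp_rw [Finset.sum_range] at this
    exact this
  · simp_rw [EuclideanSpace.norm_sq_eq, RCLike.norm_conj]
    rw [integral_finsetSum _ fun (k : Fin n) _ => (hb.memLp k).integrable_norm_pow two_ne_zero]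
    simp [hb.integral_norm_sq]

/-- The `ℓ²`-valued vector of all basis functions with square-summable weights `s`. -/
theorem exists_weightedEvalVec (hb : IsInducedONS μ V b) {s : ℕ → ℝ} (hs0 : ∀ k, 0 ≤ s k)
    (hs1 : ∀ k, s k ≤ 1) (hs : Summable fun k => s k ^ 2) :
    ∃ (v : D → lp (fun _ : ℕ => ℂ) 2) (G : Set D), MemLp v 2 μ ∧ (∀ᵐ x ∂μ, x ∈ G) ∧
      (∀ x ∈ G, ∀ h : lp (fun _ : ℕ => ℂ) 2, HasSum (fun k => s k * h k * b k x) ⟪v x, h⟫) ∧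
      (∀ h, ∫ y, ‖⟪h, v y⟫‖ ^ 2 ∂μ ≤ ‖h‖ ^ 2) ∧ ∫ y, ‖v y‖ ^ 2 ∂μ = ∑' k, s k ^ 2 := by
  classical
  let g : ℕ → D → ℂ := fun k x => s k * conj (b k x)
  have hg : ∀ k, MemLp (g k) 2 μ := fun k => (hb.memLp k).star.const_mul (s k : ℂ)
  have hgi : ∀ k, Integrable (fun x => ‖g k x‖ ^ 2) μ := fun k =>
    (hg k).integrable_norm_pow two_ne_zero
  have hgI : ∀ k, ∫ x, ‖g k x‖ ^ 2 ∂μ = s k ^ 2 := fun k => by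
    simp only [g, norm_mul, mul_pow, RCLike.norm_conj, Complex.norm_real, integral_const_mul,
      hb.integral_norm_sq, mul_one, Real.norm_eq_abs, sq_abs]
  have hgl : ∀ k, ∫⁻ x, ENNReal.ofReal (‖g k x‖ ^ 2) ∂μ = ENNReal.ofReal (s k ^ 2) := fun k => by
    rw [← hgI, ofReal_integral_eq_lintegral_ofReal (hgi k) (ae_of_all _ fun _ => sq_nonneg _)]
  have hgm : ∀ k, AEMeasurable (fun x => ENNReal.ofReal (‖g k x‖ ^ 2)) μ := fun k =>
    (hgi k).1.aemeasurable.ennreal_ofReal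
  have hlt : ∫⁻ x, ∑' k, ENNReal.ofReal (‖g k x‖ ^ 2) ∂μ = ENNReal.ofReal (∑' k, s k ^ 2) := by
    rw [lintegral_tsum hgm, ENNReal.ofReal_tsum_of_nonneg (fun _ => sq_nonneg _) hs]
    simp_rw [hgl]
  -- Integrating `∑ ‖g k x‖ ^ 2` term by term gives `∑ s k ^ 2 < ∞`, so the sequence is in `ℓ²`
  -- almost everywhere. Sample points are later taken only from `G`.
  let G : Set D := {x | Summable fun k => ‖g k x‖ ^ 2}
  have hG : ∀ᵐ x ∂μ, x ∈ G := by
    have := ae_lt_top' (AEMeasurable.tsum hgm) (by rw [hlt]; exact ENNReal.ofReal_ne_top)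
    filter_upwards [this] with x hx
    have h2 := ENNReal.summable_toReal hx.ne
    simpa [G, ENNReal.toReal_ofReal, sq_nonneg] using h2
  have hmem : ∀ x ∈ G, Memℓp (fun k => g k x) 2 := fun x hx => by
    refine memℓp_gen ?_
    simpa [G] using hx
  let v : D → lp (fun _ : ℕ => ℂ) 2 := fun x =>
    if hx : x ∈ G then ⟨fun k => g k x, hmem x hx⟩ else 0
  have hvk : ∀ x ∈ G, ∀ k, v x k = g k x := fun x hx k => by simp only [v, dif_pos hx]
  have hvnorm : ∀ x ∈ G, HasSum (fun k => ‖g k x‖ ^ 2) (‖v x‖ ^ 2) := fun x hx => by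
    have := lp.hasSum_norm (p := 2) (by norm_num) (v x)
    simpa [hvk x hx] using this
  have hvm : AEStronglyMeasurable v μ := by
    refine aestronglyMeasurable_of_tendsto_ae atTop
      (f := fun N x => ∑ k ∈ Finset.range N, lp.single 2 k (g k x)) (fun N => ?_) ?_
    · refine Finset.aestronglyMeasurable_fun_sum _ fun k _ => ?_
      exact (lp.isometry_single k).continuous.comp_aestronglyMeasurable (hg k).1
    · filter_upwards [hG] with x hx
      have := (lp.hasSum_single (p := 2) (by norm_num) (v x)).tendsto_sum_nat
      simpa only [hvk x hx] using this
  have hvl : eLpNorm v 2 μ ^ 2 = ENNReal.ofReal (∑' k, s k ^ 2) := by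
    rw [← hlt, eLpNorm_eq_lintegral_rpow_enorm_toReal two_ne_zero
      ENNReal.ofNat_ne_top, ← ENNReal.rpow_natCast, ← ENNReal.rpow_mul]
    simp only [ENNReal.toReal_ofNat, Nat.cast_ofNat, one_div]
    norm_num
    refine lintegral_congr_ae ?_
    filter_upwards [hG] with x hx
    simp only [← ofReal_norm, ← ENNReal.ofReal_pow (norm_nonneg _)]
    rw [← ENNReal.ofReal_tsum_of_nonneg (fun _ => sq_nonneg _) (hvnorm x hx).summable,
      (hvnorm x hx).tsum_eq]
  have hvL : MemLp v 2 μ := by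
    refine ⟨hvm, ?_⟩
    by_contra hcon
    rw [not_lt, top_le_iff] at hcon
    rw [hcon] at hvl
    simp at hvl
  have hsum : ∀ x ∈ G, ∀ h : lp (fun _ : ℕ => ℂ) 2,
      HasSum (fun k => s k * h k * b k x) ⟪v x, h⟫ := fun x hx h => by
    have he : (fun k => s k * h k * b k x) = fun k => ⟪v x k, h k⟫ := by
      funext k
      rw [hvk x hx]
      simp [g]
      ring
    rw [he]
    exact lp.hasSum_inner (𝕜 := ℂ) (v x) h
  refine ⟨v, G, hvL, hG, hsum, fun h => ?_, ?_⟩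
  · have h1 : MemLp (fun y => ⟪v y, h⟫) 2 μ := hvL.inner_const h
    -- The partial sums have squared norm `∑ s k ^ 2 * ‖h k‖ ^ 2 ≤ ‖h‖ ^ 2` because `s k ≤ 1`; Fatou
    -- passes to the limit.
    have h2 : eLpNorm (fun y => ⟪v y, h⟫) 2 μ ≤ ENNReal.ofReal ‖h‖ := by
      refine eLpNorm_le_of_tendsto_ae
        (F := fun N => ∑ k ∈ Finset.range N, ((s k : ℂ) * h k) • b k)
        (fun N => (hb.memLp_sum _ fun k => (s k : ℂ) * h k).1) ?_ (Eventually.of_forall fun N => ?_)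
      · filter_upwards [hG] with x hx
        simpa using (hsum x hx h).tendsto_sum_nat
      · rw [← ENNReal.pow_le_pow_left_iff two_ne_zero,
          hb.eLpNorm_sq_sum _ fun k => (s k : ℂ) * h k, ← ENNReal.ofReal_pow (norm_nonneg _)]
        refine ENNReal.ofReal_le_ofReal ?_
        have h3 := lp.hasSum_norm (p := 2) (by norm_num) h
        simp only [ENNReal.toReal_ofNat, Real.rpow_ofNat] at h3
        refine le_trans (Finset.sum_le_sum fun k _ => ?_)
          (sum_le_hasSum (Finset.range N) (fun _ _ => sq_nonneg _) h3)
        rw [norm_mul, Complex.norm_real, Real.norm_of_nonneg (hs0 k)]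
        exact pow_le_pow_left₀ (mul_nonneg (hs0 k) (norm_nonneg _))
          (mul_le_of_le_one_left (norm_nonneg _) (hs1 k)) 2
    have h4 := integral_norm_sq_eq_eLpNorm h1
    have h5 : eLpNorm (fun y => ⟪v y, h⟫) 2 μ ^ 2 ≤ ENNReal.ofReal (‖h‖ ^ 2) := by
      rw [ENNReal.ofReal_pow (norm_nonneg _)]; gcongr
    rw [← h4, ENNReal.ofReal_le_ofReal_iff (sq_nonneg _)] at h5
    simpa only [norm_inner_symm h] using h5
  · have := integral_norm_sq_eq_eLpNorm hvL
    rwa [hvl, ENNReal.ofReal_eq_ofReal_iff (integral_nonneg fun _ => sq_nonneg _)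
      (tsum_nonneg fun _ => sq_nonneg _)] at this

end IsInducedONS

/-! ### Power sums, tail weights and summation by parts -/

section Sums

theorem sum_range_rpow_neg_le {p : ℝ} (hp : 1 < p) {M : ℕ} (hM : 1 ≤ M) (N : ℕ) :
    ∑ i ∈ Finset.range N, ((M : ℝ) + (i + 1 : ℕ)) ^ (-p) ≤ (M : ℝ) ^ (1 - p) / (p - 1) := by
  have hM0 : (0 : ℝ) < M := by exact_mod_cast hM
  have hanti : AntitoneOn (fun x : ℝ => x ^ (-p)) (Set.Icc (M : ℝ) (M + N)) := by
    intro x hx y hy hxy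
    exact Real.rpow_le_rpow_of_nonpos (hM0.trans_le hx.1) hxy (by linarith)
  refine hanti.sum_le_integral.trans ?_
  rw [integral_rpow (Or.inr ⟨by linarith, fun h => ?_⟩)]
  · have h1 : 0 ≤ ((M : ℝ) + N) ^ (-p + 1) := by positivity
    have h2 : (0 : ℝ) < p - 1 := by linarith
    rw [show -p + 1 = -(p - 1) by ring, show 1 - p = -(p - 1) by ring, div_neg, ← neg_div]
    rw [show -p + 1 = -(p - 1) by ring] at h1
    gcongr
    linarith
  · rw [Set.uIcc_of_le (by simp)] at h
    linarith [h.1]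

theorem tsum_Ioi_ofReal_rpow_neg_le {p : ℝ} (hp : 1 < p) {M : ℕ} (hM : 1 ≤ M) :
    ∑' k : Set.Ioi M, ENNReal.ofReal (((k : ℕ) : ℝ) ^ (-p)) ≤
      ENNReal.ofReal ((M : ℝ) ^ (1 - p) / (p - 1)) := by
  let e : ℕ ≃ Set.Ioi M :=
    { toFun := fun i => ⟨M + (i + 1), by simp⟩
      invFun := fun k => k.1 - M - 1
      left_inv := fun i => by dsimp only; omega
      right_inv := fun k => by
        have : M < k.1 := k.2
        apply Subtype.ext
        dsimp only
        omega }
  rw [← e.tsum_eq]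
  refine ENNReal.tsum_le_of_sum_range_le fun N => ?_
  rw [← ENNReal.ofReal_sum_of_nonneg fun i _ => by positivity]
  refine ENNReal.ofReal_le_ofReal (le_trans (le_of_eq ?_) (sum_range_rpow_neg_le hp hM N))
  exact Finset.sum_congr rfl fun i _ => by simp [e]

/-- The weights of the tail vector: polynomial decay, normalised to `1` at `k = M`. -/
noncomputable def tailWeight (ε : ℝ) (M k : ℕ) : ℝ :=
  if M ≤ k then ((M : ℝ) / k) ^ ((1 + ε) / 2) else 0

theorem tailWeight_nonneg (ε : ℝ) (M k : ℕ) : 0 ≤ tailWeight ε M k := by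
  unfold tailWeight; split_ifs <;> positivity

theorem tailWeight_le_one {ε : ℝ} (hε : 0 < ε) (M k : ℕ) : tailWeight ε M k ≤ 1 := by
  unfold tailWeight
  split_ifs with h
  · refine Real.rpow_le_one (by positivity) ?_ (by positivity)
    exact div_le_one_of_le₀ (by exact_mod_cast h) (by positivity)
  · exact zero_le_one

theorem tailWeight_sq {ε : ℝ} {M k : ℕ} (h : M ≤ k) :
    tailWeight ε M k ^ 2 = ((M : ℝ) / k) ^ (1 + ε) := by
  rw [tailWeight, if_pos h, ← Real.rpow_natCast, ← Real.rpow_mul (by positivity)]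
  congr 1
  push_cast
  ring

theorem sum_range_tailWeight_sq_le {ε : ℝ} (hε : 0 < ε) {M : ℕ} (hM : 1 ≤ M) (N : ℕ) :
    ∑ k ∈ Finset.range N, tailWeight ε M k ^ 2 ≤ 1 + M / ε := by
  have hM0 : (0 : ℝ) < M := by exact_mod_cast hM
  have h1 : ∑ k ∈ Finset.range N, tailWeight ε M k ^ 2 ≤
      ∑ k ∈ Finset.range (M + 1 + N), tailWeight ε M k ^ 2 :=
    Finset.sum_le_sum_of_subset_of_nonneg (Finset.range_mono (by omega))
      fun _ _ _ => sq_nonneg _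
  refine h1.trans ?_
  rw [Finset.sum_range_add, Finset.sum_range_succ, Finset.sum_eq_zero, zero_add]
  · have h2 : tailWeight ε M M ^ 2 ≤ 1 :=
      pow_le_one₀ (tailWeight_nonneg _ _ _) (tailWeight_le_one hε _ _)
    have h3 : ∑ i ∈ Finset.range N, tailWeight ε M (M + 1 + i) ^ 2 =
        (M : ℝ) ^ (1 + ε) * ∑ i ∈ Finset.range N, ((M : ℝ) + (i + 1 : ℕ)) ^ (-(1 + ε)) := by
      rw [Finset.mul_sum]
      refine Finset.sum_congr rfl fun i _ => ?_
      rw [tailWeight_sq (by omega), Real.div_rpow hM0.le (by positivity),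
        Real.rpow_neg (by positivity), div_eq_mul_inv]
      push_cast
      congr 3
      ring
    have h4 := sum_range_rpow_neg_le (p := 1 + ε) (by linarith) hM N
    have h5 : (M : ℝ) ^ (1 + ε) * ((M : ℝ) ^ (1 - (1 + ε)) / (1 + ε - 1)) = M / ε := by
      rw [← mul_div_assoc, ← Real.rpow_add hM0, show 1 + ε + (1 - (1 + ε)) = 1 by ring,
        Real.rpow_one, show 1 + ε - 1 = ε by ring]
    have h6 := mul_le_mul_of_nonneg_left h4 (by positivity : 0 ≤ (M : ℝ) ^ (1 + ε))
    rw [h3]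
    linarith
  · intro k hk
    rw [tailWeight, if_neg (by have := Finset.mem_range.1 hk; omega)]
    norm_num

theorem summable_tailWeight_sq {ε : ℝ} (hε : 0 < ε) {M : ℕ} (hM : 1 ≤ M) :
    Summable fun k => tailWeight ε M k ^ 2 :=
  summable_of_sum_range_le (fun _ => sq_nonneg _) (sum_range_tailWeight_sq_le hε hM)

theorem tsum_tailWeight_sq_le {ε : ℝ} (hε : 0 < ε) {M : ℕ} (hM : 1 ≤ M) :
    ∑' k, tailWeight ε M k ^ 2 ≤ 1 + M / ε :=
  Real.tsum_le_of_sum_range_le (fun _ => sq_nonneg _) (sum_range_tailWeight_sq_le hε hM)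

theorem tsum_tailWeight_sq_pos {ε : ℝ} (hε : 0 < ε) {M : ℕ} (hM : 1 ≤ M) :
    0 < ∑' k, tailWeight ε M k ^ 2 := by
  refine (summable_tailWeight_sq hε hM).tsum_pos (fun _ => sq_nonneg _) M ?_
  have hM0 : (0 : ℝ) < M := by exact_mod_cast hM
  rw [tailWeight_sq le_rfl]
  positivity

/-- Summation by parts for a weighted sum of tails. -/
theorem tsum_weighted_le_tsum_tails {ε : ℝ} (hε : 0 < ε) {m : ℕ} (hm : 1 ≤ m) (q : ℕ → ℝ)
    (hq : ∀ k, 0 ≤ q k) (d : ℕ → ℝ≥0∞) (hd : ∀ k, m < k → ∀ n,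
      ENNReal.ofReal (∑ j ∈ Finset.Ico k n, q j) ≤ d k) :
    ∑' j : ℕ, ENNReal.ofReal (if 2 * m ≤ j then ((j : ℝ) / (2 * m : ℕ)) ^ (1 + ε) * q j else 0) ≤
      ENNReal.ofReal ((m : ℝ) ^ (-1 - ε)) *
        ∑' k : Set.Ioi m, ENNReal.ofReal (((k : ℕ) : ℝ) ^ ε) * d k := by
  have hm0 : (0 : ℝ) < m := by exact_mod_cast hm
  have hd' : ∀ k : Set.Ioi m, ∑' j : ℕ, (if (k : ℕ) ≤ j then ENNReal.ofReal (q j) else 0) ≤ d k := by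
    intro k
    refine ENNReal.tsum_le_of_sum_range_le fun n => le_trans (le_of_eq ?_) (hd k k.2 n)
    rw [ENNReal.ofReal_sum_of_nonneg fun j _ => hq j, ← Finset.sum_filter]
    congr 1
    ext j
    simp [and_comm]
  have h1 : ∑' j : ℕ, ∑' k : Set.Ioi m, ENNReal.ofReal (((k : ℕ) : ℝ) ^ ε) *
      (if (k : ℕ) ≤ j then ENNReal.ofReal (q j) else 0) ≤
      ∑' k : Set.Ioi m, ENNReal.ofReal (((k : ℕ) : ℝ) ^ ε) * d k := by
    rw [ENNReal.tsum_comm]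
    refine ENNReal.tsum_le_tsum fun k => ?_
    rw [ENNReal.tsum_mul_left]
    gcongr
    exact hd' k
  refine le_trans ?_ (mul_le_mul_right h1 _)
  rw [← ENNReal.tsum_mul_left]
  refine ENNReal.tsum_le_tsum fun j => ?_
  split_ifs with hj
  swap
  · simp
  have hj0 : (0 : ℝ) < j := by
    have : 0 < j := by omega
    exact_mod_cast this
  have h2 : ENNReal.ofReal (((j : ℝ) / 2) ^ (1 + ε)) * ENNReal.ofReal (q j) ≤
      ∑' k : Set.Ioi m, ENNReal.ofReal (((k : ℕ) : ℝ) ^ ε) *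
        (if (k : ℕ) ≤ j then ENNReal.ofReal (q j) else 0) := by
    rw [tsum_subtype (Set.Ioi m) fun k : ℕ => ENNReal.ofReal ((k : ℝ) ^ ε) *
      (if k ≤ j then ENNReal.ofReal (q j) else 0)]
    -- For `j ≥ 2m`, each `k` in `(j/2, j]` exceeds `m`; there are at least `j/2` of them, each with
    -- `k ^ ε ≥ (j/2) ^ ε`.
    refine le_trans ?_ (ENNReal.sum_le_tsum (Finset.Ioc (j / 2) j))
    have h3 : ∀ k ∈ Finset.Ioc (j / 2) j, ENNReal.ofReal (((j : ℝ) / 2) ^ ε) *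
        ENNReal.ofReal (q j) ≤ (Set.Ioi m).indicator (fun k : ℕ => ENNReal.ofReal ((k : ℝ) ^ ε) *
          (if k ≤ j then ENNReal.ofReal (q j) else 0)) k := by
      intro k hk
      rw [Finset.mem_Ioc] at hk
      rw [Set.indicator_of_mem (by simp only [Set.mem_Ioi]; omega), if_pos hk.2]
      have : (j : ℝ) ≤ k * 2 := by
        have : j ≤ k * 2 := by omega
        exact_mod_cast this
      gcongr
      linarith
    refine le_trans ?_ (Finset.card_nsmul_le_sum _ _ _ h3)
    rw [Nat.card_Ioc, nsmul_eq_mul, ← mul_assoc, ← ENNReal.ofReal_natCast]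
    have h4 : (j : ℝ) / 2 ≤ ((j - j / 2 : ℕ) : ℝ) := by
      have : j ≤ (j - j / 2) * 2 := by omega
      have : (j : ℝ) ≤ ((j - j / 2 : ℕ) : ℝ) * 2 := by exact_mod_cast this
      linarith
    rw [Real.rpow_add (by positivity), Real.rpow_one, ENNReal.ofReal_mul (by positivity)]
    gcongr
  refine le_trans (le_of_eq ?_) (mul_le_mul_right h2 _)
  rw [← mul_assoc, ← ENNReal.ofReal_mul (by positivity), ← ENNReal.ofReal_mul (by positivity)]
  congr 2
  rw [show (j : ℝ) / (2 * m : ℕ) = (j : ℝ) / 2 * (m : ℝ)⁻¹ by push_cast; field_simp,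
    Real.mul_rpow (by positivity) (by positivity), Real.inv_rpow hm0.le, ← Real.rpow_neg hm0.le,
    neg_add', mul_comm]

end Sums

/-! ### Weighted least squares as a discrete orthogonal projection -/

section LeastSquares

variable {D : Type*} {n : ℕ}

/-- Existence of the weighted discrete orthogonal projection. -/
theorem exists_discrete_projection (x : Fin n → D) {w : Fin n → ℝ} (hw : ∀ i, 0 < w i)
    (W : Submodule ℂ (D → ℂ)) (f : D → ℂ) :
    ∃ g ∈ W, ∀ h ∈ W, ∑ i, w i * ‖f (x i) - h (x i)‖ ^ 2 =
      ∑ i, w i * ‖f (x i) - g (x i)‖ ^ 2 + ∑ i, w i * ‖g (x i) - h (x i)‖ ^ 2 := by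
  let T : (D → ℂ) →ₗ[ℂ] EuclideanSpace ℂ (Fin n) :=
    { toFun := fun f => WithLp.toLp 2 fun i => (√(w i) : ℂ) * f (x i)
      map_add' := fun f g => by ext i; simp [mul_add]
      map_smul' := fun c f => by ext i; simp [mul_left_comm] }
  have hT : ∀ f g : D → ℂ, ‖T f - T g‖ ^ 2 = ∑ i, w i * ‖f (x i) - g (x i)‖ ^ 2 := by
    intro f g
    rw [← map_sub, EuclideanSpace.norm_sq_eq]
    refine Finset.sum_congr rfl fun i _ => ?_
    change ‖(√(w i) : ℂ) * (f (x i) - g (x i))‖ ^ 2 = _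
    rw [norm_mul, mul_pow, Complex.norm_real, Real.norm_of_nonneg (Real.sqrt_nonneg _),
      Real.sq_sqrt (hw i).le]
  set K := W.map T
  obtain ⟨g, hg, hgK⟩ : K.starProjection (T f) ∈ K := Submodule.starProjection_apply_mem _ _
  refine ⟨g, hg, fun h hh => ?_⟩
  rw [← hT, ← hT, ← hT]
  have hort : inner ℂ (T f - T g) (T g - T h) = 0 := by
    rw [hgK]
    exact Submodule.starProjection_inner_eq_zero _ _
      (K.sub_mem (Submodule.starProjection_apply_mem _ _) ⟨h, hh, rfl⟩)
  have := norm_add_sq_eq_norm_sq_add_norm_sq_of_inner_eq_zero (T f - T g) (T g - T h) hort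
  rw [sub_add_sub_cancel] at this
  simpa only [sq] using this

theorem existsUnique_isLeastSquaresFit {x : Fin n → D} {w : Fin n → ℝ} (hw : ∀ i, 0 < w i)
    {W : Submodule ℂ (D → ℂ)} (hW : ∀ g ∈ W, (∀ i, g (x i) = 0) → g = 0) (f : D → ℂ) :
    ∃! g, IsLeastSquaresFit x w W f g := by
  obtain ⟨g, hg, h⟩ := exists_discrete_projection x hw W f
  have hnn : ∀ g h : D → ℂ, ∀ i ∈ Finset.univ, 0 ≤ w i * ‖g (x i) - h (x i)‖ ^ 2 :=
    fun g h i _ => mul_nonneg (hw i).le (sq_nonneg _)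
  refine ⟨g, ⟨hg, fun k hk => ?_⟩, fun k ⟨hk, hkmin⟩ => ?_⟩
  · rw [h k hk]
    exact le_add_of_nonneg_right (Finset.sum_nonneg (hnn g k))
  · have h1 := hkmin g hg
    rw [h k hk] at h1
    have h2 : ∑ i, w i * ‖g (x i) - k (x i)‖ ^ 2 = 0 :=
      le_antisymm (by linarith) (Finset.sum_nonneg (hnn g k))
    rw [Finset.sum_eq_zero_iff_of_nonneg (hnn g k)] at h2
    refine (sub_eq_zero.1 (hW (g - k) (W.sub_mem hg hk) fun i => ?_)).symm
    have h3 := h2 i (Finset.mem_univ i)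
    rw [mul_eq_zero, or_iff_right (hw i).ne', sq_eq_zero_iff, norm_eq_zero] at h3
    exact h3

theorem leastSquares_spec {x : Fin n → D} {w : Fin n → ℝ} {W : Submodule ℂ (D → ℂ)} {f : D → ℂ}
    (h : ∃! g, IsLeastSquaresFit x w W f g) : IsLeastSquaresFit x w W f (leastSquares x w W f) :=
  Classical.epsilon_spec h.exists

/-- By Pythagoras, the projection fixes `h` and does not increase the discrete norm. -/
theorem IsLeastSquaresFit.sum_le {x : Fin n → D} {w : Fin n → ℝ} (hw : ∀ i, 0 < w i)
    {W : Submodule ℂ (D → ℂ)} {f g : D → ℂ} (hu : ∃! g, IsLeastSquaresFit x w W f g)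
    (hg : IsLeastSquaresFit x w W f g) {h : D → ℂ} (hh : h ∈ W) :
    ∑ i, w i * ‖g (x i) - h (x i)‖ ^ 2 ≤ ∑ i, w i * ‖f (x i) - h (x i)‖ ^ 2 := by
  obtain ⟨g', hg', h'⟩ := exists_discrete_projection x hw W f
  have hnn : ∀ g h : D → ℂ, 0 ≤ ∑ i, w i * ‖g (x i) - h (x i)‖ ^ 2 :=
    fun g h => Finset.sum_nonneg fun i _ => mul_nonneg (hw i).le (sq_nonneg _)
  have : g = g' := hu.unique hg ⟨hg', fun k hk => by
    rw [h' k hk]; exact le_add_of_nonneg_right (hnn _ _)⟩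
  rw [h' h hh, this]
  exact le_add_of_nonneg_left (hnn _ _)

end LeastSquares

/-! ### Padding to the exact number of distinct points -/

section Padding

/-- Enlarging the support of a sparse nonnegative weight by points of small weight. -/
theorem exists_padded_weights {D : Type*} {G : Set D} (hG : G.Infinite) {n : ℕ} {W : D →₀ ℝ}
    (hcard : W.support.card ≤ n) (hW0 : ∀ x, 0 ≤ W x) (hWG : ∀ x ∈ W.support, x ∈ G)
    {B : D → ℝ} (hB : ∀ x, 0 ≤ B x) {c : ℝ} (hc : 0 < c) :
    ∃ (x : Fin n → D) (w : Fin n → ℝ), Function.Injective x ∧ (∀ i, 0 < w i) ∧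
      (∀ i, x i ∈ G) ∧ ∀ F : D → ℝ, (∀ y, 0 ≤ F y) →
        (W.sum fun y a => a * F y) ≤ ∑ i, w i * F (x i) ∧
        ∀ r, 0 ≤ r → (∀ y, F y ≤ B y * r) →
          ∑ i, w i * F (x i) ≤ (W.sum fun y a => a * F y) + c * r := by
  classical
  obtain ⟨t', ht'G, ht'c⟩ := (hG.sdiff W.support.finite_toSet).exists_subset_card_eq
    (n - W.support.card)
  set t := W.support ∪ t' with ht
  have hdisj : Disjoint W.support t' := by
    rw [Finset.disjoint_left]
    exact fun y hy hy' => (ht'G hy').2 hy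
  have htc : t.card = n := by
    rw [ht, Finset.card_union_of_disjoint hdisj, ht'c]; omega
  have htG : ∀ y ∈ t, y ∈ G := fun y hy => by
    rcases Finset.mem_union.1 hy with hy | hy
    exacts [hWG y hy, (ht'G hy).1]
  set S := ∑ y ∈ t, B y with hS
  have hS0 : 0 ≤ S := Finset.sum_nonneg fun y _ => hB y
  -- Every point of `t` receives the extra weight `η`, small enough that the upper bound grows by at
  -- most `c * r`; the denominator `S + 1` covers `S = 0`.
  set η := c / (S + 1) with hη
  have hη0 : 0 < η := by positivity
  have hηS : η * S ≤ c := by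
    rw [hη, div_mul_eq_mul_div, div_le_iff₀ (by positivity)]
    nlinarith
  let e := t.equivFinOfCardEq htc
  have hsum : ∀ F : D → ℝ, ∑ i, (W (e.symm i : D) + η) * F (e.symm i : D) =
      (W.sum fun y a => a * F y) + η * ∑ y ∈ t, F y := by
    intro F
    rw [e.symm.sum_comp (fun y : t => (W (y : D) + η) * F (y : D)),
      Finset.sum_coe_sort t fun y => (W y + η) * F y,
      Finsupp.sum_of_support_subset W (Finset.subset_union_left : W.support ⊆ t)
        (fun y a => a * F y) fun _ _ => zero_mul _, Finset.mul_sum, ← Finset.sum_add_distrib]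
    exact Finset.sum_congr rfl fun _ _ => add_mul _ _ _
  refine ⟨fun i => e.symm i, fun i => W (e.symm i) + η,
    Subtype.val_injective.comp e.symm.injective, fun i => by have := hW0 (e.symm i); positivity,
    fun i => htG _ (e.symm i).2, fun F hF => ⟨?_, fun r hr hFr => ?_⟩⟩
  · rw [hsum]
    exact le_add_of_nonneg_right (mul_nonneg hη0.le (Finset.sum_nonneg fun y _ => hF y))
  · rw [hsum]
    refine add_le_add_right ?_ _
    calc η * ∑ y ∈ t, F y ≤ η * ∑ y ∈ t, B y * r := by
          gcongr with y hy; exact hFr y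
      _ = η * S * r := by rw [← Finset.sum_mul, mul_assoc]
      _ ≤ c * r := by gcongr

/-- If `G` had only `N` points, restriction to `G` would embed the `(N + 1)`-dimensional `V (N + 1)`
into `ℂ^N`, since an element vanishing almost everywhere is zero. -/
theorem IsNestedL2.infinite_of_ae_mem {D : Type*} [MeasurableSpace D] {μ : Measure D}
    {V : ℕ → Submodule ℂ (D → ℂ)} (hV : IsNestedL2 μ V) {G : Set D} (hG : ∀ᵐ x ∂μ, x ∈ G) :
    G.Infinite := by
  intro hfin
  have := hfin.fintype
  set N := Fintype.card G
  let T : V (N + 1) →ₗ[ℂ] (G → ℂ) :=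
    { toFun := fun g y => g.1 y
      map_add' := fun _ _ => rfl
      map_smul' := fun _ _ => rfl }
  have hT : Function.Injective T := by
    rw [← LinearMap.ker_eq_bot, LinearMap.ker_eq_bot']
    intro g hg
    refine Subtype.ext (hV.eq_zero_of_ae (N + 1) (by omega) _ g.2 ?_)
    filter_upwards [hG] with x hx
    exact congrFun hg ⟨x, hx⟩
  have h := LinearMap.finrank_le_finrank_of_injective hT
  rw [hV.finrank_eq _ (by omega), Module.finrank_fintype_fun_eq_card] at h
  omega

end Padding

/-! ### Sampling frames and the least squares error -/

section Main

variable {D : Type*} [MeasurableSpace D] {μ : Measure D}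
variable {V : ℕ → Submodule ℂ (D → ℂ)} {b : ℕ → D → ℂ}

/-- The ratio of the upper bound for the tail to the lower frame bound. -/
noncomputable def frameRatio (ε : ℝ) : ℝ := 36 + 14 / ε

/-- The discrete measure `(x, w)` has a lower frame bound `a` on `V n` and dominates the tail of
the Fourier series with constant `a * C`. -/
structure IsSamplingFrame {n N : ℕ} (b : ℕ → D → ℂ) (s : ℕ → ℝ) (x : Fin N → D) (w : Fin N → ℝ)
    (a C : ℝ) : Prop where
  lower : ∀ c : ℕ → ℂ, a * ∑ k ∈ Finset.range n, ‖c k‖ ^ 2 ≤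
    ∑ i, w i * ‖∑ k ∈ Finset.range n, c k * b k (x i)‖ ^ 2
  upper : ∀ h : lp (fun _ : ℕ => ℂ) 2, ∃ z : Fin N → ℂ,
    (∀ i, HasSum (fun k => s k * h k * b k (x i)) (z i)) ∧
    ∑ i, w i * ‖z i‖ ^ 2 ≤ a * C * ‖h‖ ^ 2

theorem IsSamplingFrame.smul {D : Type*} {b : ℕ → D → ℂ} {n N : ℕ} {s : ℕ → ℝ} {x : Fin N → D}
    {w : Fin N → ℝ} {a C : ℝ} (h : IsSamplingFrame (n := n) b s x w a C) {t : ℝ} (ht : 0 ≤ t) :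
    IsSamplingFrame (n := n) b s x (fun i => t * w i) (t * a) C := by
  refine ⟨fun c => ?_, fun z => ?_⟩
  · simp_rw [mul_assoc, ← Finset.mul_sum]
    exact mul_le_mul_of_nonneg_left (h.lower c) ht
  · obtain ⟨y, hy, hle⟩ := h.upper z
    refine ⟨y, hy, ?_⟩
    simp_rw [mul_assoc, ← Finset.mul_sum]
    simpa only [mul_assoc] using mul_le_mul_of_nonneg_left hle ht

theorem exists_isSamplingFrame (hV : IsNestedL2 μ V) (hb : IsInducedONS μ V b) {ε : ℝ}
    (hε : 0 < ε) {m : ℕ} (hm : 1 ≤ m) :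
    ∃ (x : Fin (4 * m) → D) (w : Fin (4 * m) → ℝ), Function.Injective x ∧ (∀ i, 0 < w i) ∧
      IsSamplingFrame (n := 2 * m) b (tailWeight ε (2 * m)) x w m (frameRatio ε) := by
  have hm0 : (1 : ℝ) ≤ m := by exact_mod_cast hm
  obtain ⟨u, hu, hueval, hucov, hun⟩ := hb.exists_evalVec (2 * m)
  obtain ⟨v, G, hv, hG, hveval, hvcov, hvn⟩ := hb.exists_weightedEvalVec
    (tailWeight_nonneg ε (2 * m)) (tailWeight_le_one hε (2 * m))
    (summable_tailWeight_sq hε (M := 2 * m) (by omega))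
  have ht : ∫ y, ‖v y‖ ^ 2 ∂μ ≤ 1 + 2 * m / ε := by
    rw [hvn]; exact_mod_cast tsum_tailWeight_sq_le hε (M := 2 * m) (by omega)
  obtain ⟨W, hcard, hW0, hWG, hlow, hup⟩ := exists_sparse_weights hu hv hucov hvcov
    (by rw [hun]; exact_mod_cast (by omega : 0 < 2 * m))
    (by rw [hvn]; exact tsum_tailWeight_sq_pos hε (by omega)) hG (4 * m)
  obtain ⟨x, w, hx, hw, hxG, hF⟩ := exists_padded_weights (hV.infinite_of_ae_mem hG) hcard hW0 hWG
    (B := fun y => ‖v y‖ ^ 2) (fun _ => sq_nonneg _) one_pos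
  refine ⟨x, w, hx, hw, fun c => ?_, fun h => ⟨fun i => ⟪v (x i), h⟫, fun i =>
    hveval _ (hxG i) h, ?_⟩⟩
  · have h1 := hlow (WithLp.toLp 2 fun k : Fin (2 * m) => c k)
    have h2 := (hF (fun y => ‖⟪u y, WithLp.toLp 2 fun k : Fin (2 * m) => c k⟫‖ ^ 2)
      fun _ => sq_nonneg _).1
    simp only [hueval] at h1 h2
    -- The lower constant is `4m - (3/2) * 2m = m`.
    refine le_trans (le_of_eq ?_) (h1.trans h2)
    rw [hun, EuclideanSpace.norm_sq_eq, Finset.sum_range]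
    push_cast
    ring
  · have h1 := (hF (fun y => ‖⟪v y, h⟫‖ ^ 2) fun _ => sq_nonneg _).2 (‖h‖ ^ 2) (sq_nonneg _)
      fun y => by
        rw [← mul_pow]
        exact pow_le_pow_left₀ (norm_nonneg _) (norm_inner_le_norm _ _) 2
    have h2 := hup h
    -- `7 (1 + 2m/ε) + 28m + 1 = 28m + 8 + 14m/ε`, the final `1` coming from the padding, and `8 ≤
    -- 8m`.
    have h3 : 7 * (∫ y, ‖v y‖ ^ 2 ∂μ) + 7 * ((4 * m : ℕ) : ℝ) + 1 ≤ m * frameRatio ε := by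
      rw [frameRatio]
      have : (m : ℝ) * (14 / ε) = 7 * (2 * m / ε) := by ring
      push_cast
      linarith
    have h4 := mul_le_mul_of_nonneg_right h3 (sq_nonneg ‖h‖)
    linarith

namespace IsSamplingFrame

variable {n N : ℕ} {s : ℕ → ℝ} {x : Fin N → D} {w : Fin N → ℝ} {a C : ℝ}

theorem eq_zero (h : IsSamplingFrame (n := n) b s x w a C) (hb : IsInducedONS μ V b)
    (hn : 1 ≤ n) (ha : 0 < a) : ∀ g ∈ V n, (∀ i, g (x i) = 0) → g = 0 := by
  intro g hg hgx
  obtain ⟨c, rfl⟩ := hb.exists_coeff hn hg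
  have h1 := h.lower c
  have h2 : ∀ i, ∑ k ∈ Finset.range n, c k * b k (x i) = 0 := fun i => by
    simpa using hgx i
  simp only [h2, norm_zero, ne_eq, OfNat.ofNat_ne_zero, not_false_eq_true, zero_pow, mul_zero,
    Finset.sum_const_zero] at h1
  have h3 : ∑ k ∈ Finset.range n, ‖c k‖ ^ 2 = 0 :=
    le_antisymm (nonpos_of_mul_nonpos_right h1 ha) (Finset.sum_nonneg fun _ _ => sq_nonneg _)
  rw [Finset.sum_eq_zero_iff_of_nonneg fun _ _ => sq_nonneg _] at h3
  refine Finset.sum_eq_zero fun k hk => ?_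
  have := h3 k hk
  rw [sq_eq_zero_iff, norm_eq_zero] at this
  rw [this, zero_smul]

end IsSamplingFrame

/-- Error bound for weighted least squares in terms of the weighted tail of the Fourier
coefficients. -/
theorem eLpNorm_sub_leastSquares_sq_le (hb : IsInducedONS μ V b) {ε : ℝ} (hε : 0 < ε) {n N : ℕ}
    (hn : 1 ≤ n) {x : Fin N → D} {w : Fin N → ℝ} {a C : ℝ} (hw : ∀ i, 0 < w i) (ha : 0 < a)
    (hC : 0 ≤ C) (hfr : IsSamplingFrame (n := n) b (tailWeight ε n) x w a C) {f : D → ℂ}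
    (hf : MemLp f 2 μ) (hfb : ∀ y, Tendsto
      (fun N : ℕ => ∑ k ∈ Finset.range N, l2Inner μ f (b k) * b k y) atTop (𝓝 (f y))) :
    eLpNorm (f - leastSquares x w (V n) f) 2 μ ^ 2 ≤ ENNReal.ofReal (2 * (1 + C)) *
      ∑' j : ℕ, ENNReal.ofReal
        (if n ≤ j then ((j : ℝ) / n) ^ (1 + ε) * ‖l2Inner μ f (b j)‖ ^ 2 else 0) := by
  set c : ℕ → ℂ := fun k => l2Inner μ f (b k) with hc
  set r : ℕ → ℝ := fun j => if n ≤ j then ((j : ℝ) / n) ^ (1 + ε) * ‖c j‖ ^ 2 else 0 with hr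
  have hn0 : (0 : ℝ) < n := by exact_mod_cast hn
  have hr0 : ∀ j, 0 ≤ r j := fun j => by
    simp only [hr]; split_ifs <;> positivity
  by_cases htop : ∑' j, ENNReal.ofReal (r j) = ⊤
  · rw [htop, ENNReal.mul_top]
    · exact le_top
    · exact (ENNReal.ofReal_pos.2 (by positivity)).ne'
  have hrs : Summable r := by
    have := ENNReal.summable_toReal htop
    simpa [ENNReal.toReal_ofReal, hr0] using this
  -- the coefficient vector relative to the weighted tail
  let hc' : ℕ → ℂ := fun k => c k / (tailWeight ε n k : ℂ)
  have htw : ∀ k, n ≤ k → 0 < tailWeight ε n k := fun k hk => by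
    have hk0 : (0 : ℝ) < k := hn0.trans_le (by exact_mod_cast hk)
    rw [tailWeight, if_pos hk]
    positivity
  have hnorm : ∀ k, ‖hc' k‖ ^ 2 = r k := fun k => by
    by_cases hk : n ≤ k
    · have hk0 : (0 : ℝ) < k := hn0.trans_le (by exact_mod_cast hk)
      simp only [hc', hr, if_pos hk]
      rw [norm_div, div_pow, Complex.norm_real, Real.norm_eq_abs, sq_abs, tailWeight_sq hk,
        div_eq_mul_inv, ← Real.inv_rpow (by positivity), inv_div, mul_comm]
    · simp [hc', hr, hk, tailWeight]
  have hcr : ∀ k, n ≤ k → ‖c k‖ ^ 2 ≤ r k := fun k hk => by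
    rw [hr]
    simp only [if_pos hk]
    refine le_mul_of_one_le_left (sq_nonneg _) (Real.one_le_rpow ?_ (by positivity))
    rw [one_le_div hn0]
    exact_mod_cast hk
  let h : lp (fun _ : ℕ => ℂ) 2 := ⟨hc', memℓp_gen (by simpa [hnorm] using hrs)⟩
  have hh : ‖h‖ ^ 2 = ∑' j, r j := by
    have h1 := lp.hasSum_norm (p := 2) (by norm_num) h
    simp only [ENNReal.toReal_ofNat, Real.rpow_ofNat] at h1
    rw [← h1.tsum_eq]
    exact tsum_congr fun j => hnorm j
  have hS : ENNReal.ofReal (‖h‖ ^ 2) = ∑' j, ENNReal.ofReal (r j) := by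
    rw [hh, ENNReal.ofReal_tsum_of_nonneg hr0 hrs]
  set g : D → ℂ := ∑ k ∈ Finset.range n, c k • b k with hg
  have hgV : g ∈ V n := hb.sum_mem c
  have hgL : MemLp g 2 μ := hb.memLp_sum _ c
  have hgy : ∀ y, g y = ∑ k ∈ Finset.range n, c k * b k y := fun y => by simp [hg]
  obtain ⟨z, hz, hzle⟩ := hfr.upper h
  -- Both sides are limits of the same series at `x i`. Convergence at every point, not just almost
  -- everywhere, is what allows evaluation at the samples.
  have hfg : ∀ i, f (x i) - g (x i) = z i := fun i => by
    refine tendsto_nhds_unique ((hfb (x i)).sub_const (g (x i))) ?_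
    have he : ∀ k, (tailWeight ε n k : ℂ) * h k * b k (x i) =
        if n ≤ k then c k * b k (x i) else 0 := fun k => by
      split_ifs with hk
      · have : (tailWeight ε n k : ℂ) ≠ 0 := by exact_mod_cast (htw k hk).ne'
        change (tailWeight ε n k : ℂ) * (c k / (tailWeight ε n k : ℂ)) * _ = _
        rw [mul_div_cancel₀ _ this]
      · simp [tailWeight, hk]
    have hzi := (hz i).tendsto_sum_nat
    simp only [he] at hzi
    refine hzi.congr' ?_
    filter_upwards [eventually_ge_atTop n] with N hN
    rw [hgy, ← Finset.sum_range_add_sum_Ico _ hN, ← Finset.sum_range_add_sum_Ico _ hN,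
      add_sub_cancel_left, Finset.sum_eq_zero, zero_add]
    · exact Finset.sum_congr rfl fun k hk => if_pos (Finset.mem_Ico.1 hk).1
    · exact fun k hk => if_neg (by have := Finset.mem_range.1 hk; omega)
  have hu := existsUnique_isLeastSquaresFit hw (hfr.eq_zero hb hn ha) f
  set A := leastSquares x w (V n) f with hA
  have hAfit : IsLeastSquaresFit x w (V n) f A := leastSquares_spec hu
  have hAle := hAfit.sum_le hw hu hgV
  simp only [hfg] at hAle
  have hA1 : eLpNorm (A - g) 2 μ ^ 2 ≤ ENNReal.ofReal (C * ‖h‖ ^ 2) := by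
    obtain ⟨e, he⟩ := hb.exists_coeff hn ((V n).sub_mem hAfit.1 hgV)
    have h1 := hfr.lower e
    have h2 : ∀ i, ∑ k ∈ Finset.range n, e k * b k (x i) = A (x i) - g (x i) := fun i => by
      have := congrFun he (x i)
      simpa using this.symm
    simp only [h2] at h1
    rw [he, hb.eLpNorm_sq_sum]
    refine ENNReal.ofReal_le_ofReal (le_of_mul_le_mul_left ?_ ha)
    linarith
  -- The weights `(k/n)^(1+ε)` are at least `1` on the tail, so `‖h‖ ^ 2` also dominates the
  -- truncation error.
  have hf1 : eLpNorm (f - g) 2 μ ^ 2 ≤ ENNReal.ofReal (‖h‖ ^ 2) := by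
    rw [ENNReal.ofReal_pow (norm_nonneg _)]
    refine pow_le_pow_left' (eLpNorm_le_of_tendsto_ae
      (F := fun N => ∑ k ∈ Finset.Ico n N, c k • b k) (fun N => (hb.memLp_sum _ c).1)
      (ae_of_all _ fun y => ?_) (Eventually.of_forall fun N => ?_)) 2
    · refine ((hfb y).sub_const (g y)).congr' ?_
      filter_upwards [eventually_ge_atTop n] with N hN
      rw [hgy, ← Finset.sum_range_add_sum_Ico _ hN, add_sub_cancel_left]
      simp [hc]
    · rw [← ENNReal.pow_le_pow_left_iff two_ne_zero, hb.eLpNorm_sq_sum,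
        ← ENNReal.ofReal_pow (norm_nonneg _), hh]
      refine ENNReal.ofReal_le_ofReal ?_
      exact (Finset.sum_le_sum fun k hk => hcr k (Finset.mem_Ico.1 hk).1).trans
        (hrs.sum_le_tsum _ fun k _ => hr0 k)
  have hAL : MemLp A 2 μ := by
    obtain ⟨e, he⟩ := hb.exists_coeff hn hAfit.1
    rw [he]
    exact hb.memLp_sum _ e
  have htri : eLpNorm (f - A) 2 μ ≤ eLpNorm (f - g) 2 μ + eLpNorm (A - g) 2 μ := by
    have : f - A = (f - g) - (A - g) := by abel
    rw [this]
    exact eLpNorm_sub_le (hf.sub hgL).1 (hAL.sub hgL).1 one_le_two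
  calc eLpNorm (f - A) 2 μ ^ 2 ≤ (eLpNorm (f - g) 2 μ + eLpNorm (A - g) 2 μ) ^ 2 := by gcongr
    _ ≤ 2 * (eLpNorm (f - g) 2 μ ^ 2 + eLpNorm (A - g) 2 μ ^ 2) := by
        have := ENNReal.rpow_add_le_mul_rpow_add_rpow (eLpNorm (f - g) 2 μ)
          (eLpNorm (A - g) 2 μ) (p := 2) one_le_two
        norm_num at this
        exact this
    _ ≤ 2 * (ENNReal.ofReal (‖h‖ ^ 2) + ENNReal.ofReal (C * ‖h‖ ^ 2)) := by gcongr
    _ = ENNReal.ofReal (2 * (1 + C)) * ∑' j, ENNReal.ofReal (r j) := by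
        rw [← hS]
        have ht : 0 ≤ ‖h‖ ^ 2 := sq_nonneg _
        generalize ‖h‖ ^ 2 = t at ht ⊢
        rw [← ENNReal.ofReal_mul (by positivity),
          ← ENNReal.ofReal_add (by positivity) (by positivity),
          ← ENNReal.ofReal_ofNat, ← ENNReal.ofReal_mul (by positivity)]
        congr 1
        ring

end Main

end SamplingApprox

/-! ### Assembly of the theorem -/

open SamplingApprox

theorem theorem3p20 (ε : ℝ) (hε : 0 < ε) :
    ∃ C : ℝ, 0 < C ∧ ∃ K : ℝ → ℝ, (∀ α, 0 < K α) ∧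
      ∀ (D : Type u) [MeasurableSpace D] (μ : Measure D) (V : ℕ → Submodule ℂ (D → ℂ)),
        IsNestedL2 μ V → ∀ m : ℕ, 1 ≤ m →
        ∃ (x : Fin (4 * m) → D) (w : Fin (4 * m) → ℝ),
          Function.Injective x ∧ (∀ i, 0 < w i) ∧
          -- the least squares problem on `V (2 * m)` is uniquely solvable for all data
          (∀ f : D → ℂ, ∃! g, IsLeastSquaresFit x w (V (2 * m)) f g) ∧
          (∀ f : D → ℂ, MemLp f 2 μ → HasPointwiseFourierSeries μ V f →
            eLpNorm (f - leastSquares x w (V (2 * m)) f) 2 μ ^ 2 ≤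
                ENNReal.ofReal (C * (m : ℝ) ^ (-1 - ε)) *
                  ∑' k : Set.Ioi m,
                    ENNReal.ofReal (((k : ℕ) : ℝ) ^ ε) * bestL2Error μ (V k) f ^ 2 ∧
            ∀ α : ℝ, 1 / 2 + ε / 2 < α → ∀ c : ℝ, 0 < c →
              (∀ k : ℕ, 2 ≤ k → bestL2Error μ (V k) f ≤ ENNReal.ofReal (c * (k : ℝ) ^ (-α))) →
              eLpNorm (f - leastSquares x w (V (2 * m)) f) 2 μ ≤
                ENNReal.ofReal (K α * c * (m : ℝ) ^ (-α))) ∧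
          (IsProbabilityMeasure μ → (∀ z : ℂ, (fun _ => z) ∈ V m) → ∑ i, |w i| ≤ 9) := by
  set C : ℝ := 2 * (1 + frameRatio ε) with hCdef
  have hfr0 : 0 < frameRatio ε := by unfold frameRatio; positivity
  have hC : 0 < C := by positivity
  -- The summand `1` keeps `K α` positive for inadmissible `α`, where the square root takes the
  -- value `0`.
  refine ⟨C, hC, fun α => √(C / (2 * α - 1 - ε)) + 1, fun α => by positivity, ?_⟩
  intro D _ μ V hV m hm
  have hm0 : (0 : ℝ) < m := by exact_mod_cast hm
  obtain ⟨b, hb⟩ := hV.exists_isInducedONS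
  obtain ⟨x, w₀, hx, hw₀, hfr₀⟩ := exists_isSamplingFrame hV hb hε hm
  have hne : (Finset.univ : Finset (Fin (4 * m))).Nonempty := ⟨⟨0, by omega⟩, Finset.mem_univ _⟩
  -- the algorithm is invariant under scaling of the weights, so they may be normalised
  set S := ∑ i, w₀ i with hSdef
  have hS : 0 < S := Finset.sum_pos (fun i _ => hw₀ i) hne
  have hfr := hfr₀.smul (inv_nonneg.2 hS.le)
  have hw : ∀ i, 0 < S⁻¹ * w₀ i := fun i => mul_pos (inv_pos.2 hS) (hw₀ i)
  have ha : 0 < S⁻¹ * m := mul_pos (inv_pos.2 hS) hm0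
  have hbound : ∀ f : D → ℂ, MemLp f 2 μ → HasPointwiseFourierSeries μ V f →
      eLpNorm (f - leastSquares x (fun i => S⁻¹ * w₀ i) (V (2 * m)) f) 2 μ ^ 2 ≤
        ENNReal.ofReal (C * (m : ℝ) ^ (-1 - ε)) *
          ∑' k : Set.Ioi m, ENNReal.ofReal (((k : ℕ) : ℝ) ^ ε) * bestL2Error μ (V k) f ^ 2 := by
    rintro f hf ⟨b', hb', hfb'⟩
    have hfb : ∀ y, Tendsto (fun N : ℕ => ∑ k ∈ Finset.range N, l2Inner μ f (b k) * b k y)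
        atTop (𝓝 (f y)) := fun y => by
      refine (hfb' y).congr fun N => Finset.sum_congr rfl fun k _ => ?_
      exact congrFun (hb.fourier_term_eq hb' f k) y
    refine (eLpNorm_sub_leastSquares_sq_le hb hε (by omega) hw ha hfr0.le hfr hf hfb).trans ?_
    rw [ENNReal.ofReal_mul hC.le, mul_assoc]
    refine mul_le_mul_right ?_ _
    exact tsum_weighted_le_tsum_tails hε hm (fun j => ‖l2Inner μ f (b j)‖ ^ 2)
      (fun _ => sq_nonneg _) (fun k => bestL2Error μ (V k) f ^ 2)
      fun k hk N => hb.sum_le_bestL2Error_sq hf (by omega) N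
  refine ⟨x, fun i => S⁻¹ * w₀ i, hx, hw,
    existsUnique_isLeastSquaresFit hw (hfr.eq_zero hb (by omega) ha),
    fun f hf hfs => ⟨hbound f hf hfs, fun α hα c hc hd => ?_⟩, fun _ _ => ?_⟩
  · have hp : 1 < 2 * α - ε := by linarith
    have hp' : 0 < 2 * α - 1 - ε := by linarith
    have h1 : ∑' k : Set.Ioi m, ENNReal.ofReal (((k : ℕ) : ℝ) ^ ε) * bestL2Error μ (V k) f ^ 2 ≤
        ENNReal.ofReal (c ^ 2) *
          ENNReal.ofReal ((m : ℝ) ^ (1 - (2 * α - ε)) / (2 * α - ε - 1)) := by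
      refine le_trans ?_ (mul_le_mul_right (tsum_Ioi_ofReal_rpow_neg_le hp hm) _)
      rw [← ENNReal.tsum_mul_left]
      refine ENNReal.tsum_le_tsum fun k => ?_
      have hk : m < (k : ℕ) := k.2
      have hk0 : (0 : ℝ) < (k : ℕ) := by
        have : 0 < (k : ℕ) := by omega
        exact_mod_cast this
      calc _ ≤ ENNReal.ofReal (((k : ℕ) : ℝ) ^ ε) *
            ENNReal.ofReal (c * ((k : ℕ) : ℝ) ^ (-α)) ^ 2 := by
              gcongr
              -- `k > m ≥ 1` gives `k ≥ 2`, the range in which decay is assumed.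
              exact hd k (by omega)
        _ = _ := by
              rw [← ENNReal.ofReal_pow (by positivity), ← ENNReal.ofReal_mul (by positivity),
                ← ENNReal.ofReal_mul (by positivity)]
              congr 1
              rw [mul_pow, ← Real.rpow_natCast (_ ^ (-α)), ← Real.rpow_mul hk0.le,
                mul_left_comm, ← Real.rpow_add hk0]
              congr 2
              push_cast
              ring
    have h2 := (hbound f hf hfs).trans (mul_le_mul_right h1 _)
    rw [← ENNReal.pow_le_pow_left_iff two_ne_zero]
    refine h2.trans ?_
    rw [← ENNReal.ofReal_mul (by positivity), ← ENNReal.ofReal_mul (by positivity),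
      ← ENNReal.ofReal_pow (by positivity)]
    refine ENNReal.ofReal_le_ofReal ?_
    have h3 : C * (m : ℝ) ^ (-1 - ε) *
        (c ^ 2 * ((m : ℝ) ^ (1 - (2 * α - ε)) / (2 * α - ε - 1))) =
        (√(C / (2 * α - 1 - ε)) * c * (m : ℝ) ^ (-α)) ^ 2 := by
      have e1 : (m : ℝ) ^ (-1 - ε) * (m : ℝ) ^ (1 - (2 * α - ε)) = ((m : ℝ) ^ (-α)) ^ 2 := by
        rw [← Real.rpow_natCast, ← Real.rpow_mul hm0.le, ← Real.rpow_add hm0]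
        congr 1
        push_cast
        ring
      rw [mul_pow, mul_pow, Real.sq_sqrt (by positivity), ← e1,
        show 2 * α - ε - 1 = 2 * α - 1 - ε by ring]
      ring
    rw [h3]
    gcongr
    linarith
  -- The normalised weights sum to exactly `1`.
  · simp_rw [abs_of_pos (hw _)]
    rw [← Finset.mul_sum, ← hSdef, inv_mul_cancel₀ hS.ne']
    norm_num
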